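/- All groups are finite. For a finite group $G$, let $\pi(G)$ be the set of primes that occur as orders of elements of $G$. The Gruenberg--Kegel graph (prime graph) $\Gamma(G)$ is the simple graph with vertex set $\pi(G)$ in which two distinct primes $r,s$ are adjacent if and only if $G$ has an element of order $rs$. The group $G$ is unrecognizable (by Gruenberg--Kegel graph) if there are infinitely many pairwise non-isomorphic finite groups $H$ with $\Gamma(H)=\Gamma(G)$, where equality means the same vertex set and the same adjacency relation. Proposition. Let $G\cong G_2(3)$, where $G_2(3)$ is the automorphism group of the split octonion algebra over the field with $3$ elements. Then: 1. $G$ is unrecognizable by Gruenberg--Kegel graph. 2. $\Gamma(G)=\Gamma(PSL_2(13))$. 3. There are a finite field $K$ of characteristic $2$ and a $6$-dimensional irreducible $K[PSL_2(13)]$-module $V$ such that every element of $PSL_2(13)$ of order $7$ or $13$ acts fixed-point-freely on $V$ (that is, it fixes only the zero vector), and $$\Gamma(V\rtimes PSL_2(13))=\Gamma(PSL_2(13))=\Gamma(G).$$ -/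

import Mathlib

open scoped MatrixGroups

/-! ## The Gruenberg–Kegel graph -/

/-- The prime spectrum `π(G)`: the primes that occur as the order of an element of `G`. -/
def primeSpectrumOfGroup (G : Type*) [Group G] : Set ℕ :=
  {p | p.Prime ∧ ∃ g : G, orderOf g = p}

/-- The Gruenberg–Kegel graph `Γ(G)`: the vertices are the elements of `π(G)`, and distinct
vertices `p`, `q` are adjacent iff `G` has an element of order `p * q`. It is stored as a subgraph
of the complete graph on `ℕ`, so that equality of two such graphs means the same vertex set
and the same adjacency relation. -/
def gruenbergKegelGraph (G : Type*) [Group G] : (⊤ : SimpleGraph ℕ).Subgraph where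
  verts := primeSpectrumOfGroup G
  Adj p q := p ∈ primeSpectrumOfGroup G ∧ q ∈ primeSpectrumOfGroup G ∧ p ≠ q ∧
    ∃ g : G, orderOf g = p * q
  adj_sub := fun h => (SimpleGraph.top_adj _ _).2 h.2.2.1
  edge_vert := fun h => h.1
  symm := ⟨fun p q h => ⟨h.2.1, h.1, h.2.2.1.symm, by rw [mul_comm]; exact h.2.2.2⟩⟩

/-- `G` is unrecognizable by its Gruenberg–Kegel graph: there are infinitely many pairwise
non-isomorphic finite groups with the same Gruenberg–Kegel graph as `G`. (Every finite group is
isomorphic to one whose underlying type lies in `Type`.) -/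
def IsUnrecognizable (G : Type*) [Group G] : Prop :=
  ∃ (H : ℕ → Type) (_ : ∀ n, Group (H n)),
    (∀ n, Finite (H n)) ∧
    (∀ n, gruenbergKegelGraph (H n) = gruenbergKegelGraph G) ∧
    ∀ m n, m ≠ n → IsEmpty (H m ≃* H n)

/-! ## The group `G₂(k)` -/

/-- The underlying space of Zorn's vector matrix algebra over `k`: the quadruple `(a, v, w, b)`
stands for the vector matrix with diagonal entries `a`, `b` and off-diagonal entries `v`, `w`. -/
abbrev ZornMatrix (k : Type*) : Type _ := k × (Fin 3 → k) × (Fin 3 → k) × k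

open scoped Matrix in
/-- The product of Zorn vector matrices. It makes `ZornMatrix k` the split octonion algebra
over `k`, with unit `(1, 0, 0, 1)` and multiplicative norm `a b - v ⬝ᵥ w`. -/
def zornMul {k : Type*} [Field k] (x y : ZornMatrix k) : ZornMatrix k :=
  (x.1 * y.1 + x.2.1 ⬝ᵥ y.2.2.1,
   x.1 • y.2.1 + y.2.2.2 • x.2.1 - x.2.2.1 ⨯₃ y.2.2.1,
   y.1 • x.2.2.1 + x.2.2.2 • y.2.2.1 + x.2.1 ⨯₃ y.2.1,
   x.2.2.1 ⬝ᵥ y.2.1 + x.2.2.2 * y.2.2.2)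

/-- The group `G₂(k)`: the automorphism group of the split octonion algebra over the
field `k`. For the field with `q` elements this is `G₂(q)`. -/
def G₂ (k : Type*) [Field k] : Subgroup (ZornMatrix k ≃ₗ[k] ZornMatrix k) where
  carrier := {f | ∀ x y, f (zornMul x y) = zornMul (f x) (f y)}
  one_mem' := fun _ _ => rfl
  mul_mem' := by
    intro f g hf hg x y
    simp only [Set.mem_ofPred_eq] at hf hg
    simp only [LinearEquiv.mul_apply, hg, hf]
  inv_mem' := by
    intro f hf x y
    simp only [Set.mem_ofPred_eq] at hf
    change f.symm (zornMul x y) = zornMul (f.symm x) (f.symm y)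
    rw [LinearEquiv.symm_apply_eq, hf, LinearEquiv.apply_symm_apply, LinearEquiv.apply_symm_apply]

/-! ## The semidirect product of a module with the group acting on it -/

section

variable {K G V : Type*} [Field K] [Group G] [AddCommGroup V] [Module K V]

/-- The action of `G` on the additive group of a `G`-module `V` by group automorphisms, with that
additive group written multiplicatively. -/
def Representation.toMulAutMultiplicative (ρ : Representation K G V) :
    G →* MulAut (Multiplicative V) where
  toFun g :=
    { toFun := fun v => Multiplicative.ofAdd (ρ g v.toAdd)
      invFun := fun v => Multiplicative.ofAdd (ρ g⁻¹ v.toAdd)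
      left_inv := fun v => by simp
      right_inv := fun v => by simp
      map_mul' := fun v w => by simp }
  map_one' := by ext v; simp
  map_mul' g h := by ext v; simp

/-- The semidirect product `V ⋊ G` for a `G`-module `V` with action `ρ`. -/
abbrev Representation.SemidirectGroup (ρ : Representation K G V) : Type _ :=
  Multiplicative V ⋊[ρ.toMulAutMultiplicative] G

end

/-! Both `G₂(3)` and `PSL(2, 13)` satisfy `HasEdgeTwoThree`, which determines the graph: the edge `2
— 3` and two isolated vertices `7` and `13`.

Let `V` be a module in characteristic `2` on which elements of order `7` and `13` fix only zero. An
element of `V ⋊ G` over one of order `7` or `13` has the same order, and over any other element the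
order grows at most by a factor `2`. So `V ⋊ G` inherits `HasEdgeTwoThree` from `G`
(`SevenThirteenFree.hasEdgeTwoThree`). The same holds for `V ^ n`, and the orders `|V| ^ n * |G|`
tell these groups apart.

For `PSL(2, 13)`, Cayley–Hamilton makes element orders a question about thirteen traces. The module
is given by matrices over the field with four elements. They define a homomorphism because the
Bruhat relations present `SL(2, F)` (`BruhatData.toFun_mul`). It is irreducible because `4` has
order `6` modulo `13`.

For `G₂(3)`, the group acts on the `3 ^ 6 - 1 = 728 = 2 ^ 3 * 7 * 13` nonzero octonions of square
zero. For a prime `p ≥ 5`, a Sylow `p`-subgroup acts freely on them (`eq_one_of_smul_singular`), so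
its order divides `728`. Explicit elements of orders `7` and `13` generate their own centralizers
(`mem_zpowers_seven`, `mem_zpowers_thirteen`), and by Sylow's theorem `7` and `13` divide no other
element order. -/

/-! ## Groups whose prime graph is `2 — 3`, `7`, `13` -/

/-- The orders of the elements of `G` are such that the Gruenberg–Kegel graph of `G` has vertices
`2`, `3`, `7`, `13` and a single edge, between `2` and `3`. -/
structure HasEdgeTwoThree (G : Type*) [Group G] : Prop where
  exists_six : ∃ g : G, orderOf g = 6
  exists_seven : ∃ g : G, orderOf g = 7
  exists_thirteen : ∃ g : G, orderOf g = 13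
  prime_dvd : ∀ (g : G) (p : ℕ), p.Prime → p ∣ orderOf g →
    p = 2 ∨ p = 3 ∨ (p = 7 ∧ orderOf g = 7) ∨ (p = 13 ∧ orderOf g = 13)

namespace HasEdgeTwoThree

variable {G H : Type*} [Group G] [Group H]

theorem mem_primeSpectrum_iff (h : HasEdgeTwoThree G) (p : ℕ) :
    p ∈ primeSpectrumOfGroup G ↔ p = 2 ∨ p = 3 ∨ p = 7 ∨ p = 13 := by
  constructor
  · rintro ⟨hp, g, hg⟩
    have := h.prime_dvd g p hp (by rw [hg])
    tauto
  · obtain ⟨g, hg⟩ := h.exists_six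
    rintro (rfl | rfl | rfl | rfl)
    · exact ⟨by norm_num, g ^ 3, by rw [orderOf_pow_of_dvd (by norm_num) (hg ▸ by norm_num), hg]⟩
    · exact ⟨by norm_num, g ^ 2, by rw [orderOf_pow_of_dvd (by norm_num) (hg ▸ by norm_num), hg]⟩
    · exact ⟨by norm_num, h.exists_seven⟩
    · exact ⟨by norm_num, h.exists_thirteen⟩

theorem adj_iff (h : HasEdgeTwoThree G) (p q : ℕ) :
    (gruenbergKegelGraph G).Adj p q ↔ (p = 2 ∧ q = 3) ∨ (p = 3 ∧ q = 2) := by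
  constructor
  · rintro ⟨hp, hq, hne, g, hg⟩
    have h1 := h.prime_dvd g p hp.1 (by rw [hg]; exact dvd_mul_right _ _)
    have h2 := h.prime_dvd g q hq.1 (by rw [hg]; exact dvd_mul_left _ _)
    have := hp.1.two_le
    have := hq.1.two_le
    rw [hg] at h1 h2
    rcases h1 with rfl | rfl | ⟨rfl, h1⟩ | ⟨rfl, h1⟩ <;>
      rcases h2 with rfl | rfl | ⟨rfl, h2⟩ | ⟨rfl, h2⟩ <;> omega
  · obtain ⟨g, hg⟩ := h.exists_six
    rintro (⟨rfl, rfl⟩ | ⟨rfl, rfl⟩) <;>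
      exact ⟨(h.mem_primeSpectrum_iff _).2 (by norm_num), (h.mem_primeSpectrum_iff _).2 (by norm_num),
        by norm_num, g, hg⟩

theorem gruenbergKegelGraph_eq (hG : HasEdgeTwoThree G) (hH : HasEdgeTwoThree H) :
    gruenbergKegelGraph G = gruenbergKegelGraph H := by
  refine SimpleGraph.Subgraph.ext ?_ ?_
  · ext p
    exact (hG.mem_primeSpectrum_iff p).trans (hH.mem_primeSpectrum_iff p).symm
  · ext p q
    rw [hG.adj_iff, hH.adj_iff]

theorem of_mulEquiv (e : G ≃* H) (h : HasEdgeTwoThree H) : HasEdgeTwoThree G where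
  exists_six := let ⟨g, hg⟩ := h.exists_six; ⟨e.symm g, by rw [e.symm.orderOf_eq, hg]⟩
  exists_seven := let ⟨g, hg⟩ := h.exists_seven; ⟨e.symm g, by rw [e.symm.orderOf_eq, hg]⟩
  exists_thirteen := let ⟨g, hg⟩ := h.exists_thirteen; ⟨e.symm g, by rw [e.symm.orderOf_eq, hg]⟩
  prime_dvd g p hp hd := by
    rw [← e.orderOf_eq g] at hd ⊢
    exact h.prime_dvd _ p hp hd

end HasEdgeTwoThree

/-! ## Semidirect products with modules in characteristic two -/

section Semidirect

variable {K G V : Type*} [Field K] [Group G] [AddCommGroup V] [Module K V]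

/-- The elements of order `7` and `13` act fixed-point-freely. -/
def Representation.SevenThirteenFree (ρ : Representation K G V) : Prop :=
  ∀ g : G, orderOf g = 7 ∨ orderOf g = 13 → ∀ v : V, ρ g v = v → v = 0

theorem Representation.conj_inl (ρ : Representation K G V) (x : ρ.SemidirectGroup)
    (w : Multiplicative V) :
    x * SemidirectProduct.inl w * x⁻¹ =
      SemidirectProduct.inl (ρ.toMulAutMultiplicative x.right w) := by
  ext
  · simp [mul_comm]
  · simp

theorem Representation.exists_inl_eq_pow_orderOf_right (ρ : Representation K G V)
    (x : ρ.SemidirectGroup) :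
    ∃ w : Multiplicative V, SemidirectProduct.inl w = x ^ orderOf x.right := by
  have h : x ^ orderOf x.right ∈ (SemidirectProduct.rightHom
      (φ := ρ.toMulAutMultiplicative)).ker := by
    rw [MonoidHom.mem_ker, map_pow]
    exact pow_orderOf_eq_one x.right
  rw [← SemidirectProduct.range_inl_eq_ker_rightHom] at h
  exact h

/-- The power of `x` that kills its image in `G` lies in `V`, which has exponent dividing `2`. -/
theorem Representation.orderOf_dvd_two_mul [CharP K 2] (ρ : Representation K G V)
    (x : ρ.SemidirectGroup) : orderOf x ∣ orderOf x.right * 2 := by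
  obtain ⟨w, hw⟩ := ρ.exists_inl_eq_pow_orderOf_right x
  rw [orderOf_dvd_iff_pow_eq_one, pow_mul, ← hw, ← map_pow]
  have h : w ^ 2 = 1 := by
    have h2 : (2 : K) = 0 := CharTwo.two_eq_zero
    apply Multiplicative.toAdd.injective
    rw [toAdd_pow, toAdd_one, ← Nat.cast_smul_eq_nsmul K, Nat.cast_ofNat, h2, zero_smul]
  rw [h, map_one]

/-- `x` commutes with its own power in `V`, so that vector is fixed by `x.right` and vanishes. -/
theorem Representation.orderOf_dvd_of_fixedPointFree (ρ : Representation K G V)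
    (x : ρ.SemidirectGroup) (h : ∀ v : V, ρ x.right v = v → v = 0) :
    orderOf x ∣ orderOf x.right := by
  obtain ⟨w, hw⟩ := ρ.exists_inl_eq_pow_orderOf_right x
  have h1 := ρ.conj_inl x w
  have h2 : x * SemidirectProduct.inl w * x⁻¹ = SemidirectProduct.inl w := by
    rw [hw, ← pow_succ', pow_succ, mul_inv_cancel_right]
  rw [h1] at h2
  have h3 := h w.toAdd (congrArg Multiplicative.toAdd (SemidirectProduct.inl_injective h2))
  rw [orderOf_dvd_iff_pow_eq_one, ← hw, show w = 1 from Multiplicative.toAdd.injective h3, map_one]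

theorem Representation.SevenThirteenFree.hasEdgeTwoThree [CharP K 2] {ρ : Representation K G V}
    (hρ : ρ.SevenThirteenFree) (hG : HasEdgeTwoThree G) : HasEdgeTwoThree ρ.SemidirectGroup := by
  have key : ∀ n, (∃ g : G, orderOf g = n) → ∃ g : ρ.SemidirectGroup, orderOf g = n := by
    rintro n ⟨g, rfl⟩
    exact ⟨SemidirectProduct.inr g, orderOf_injective _ SemidirectProduct.inr_injective g⟩
  refine ⟨key 6 hG.exists_six, key 7 hG.exists_seven, key 13 hG.exists_thirteen, ?_⟩
  intro x p hp hdvd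
  rcases (hp.dvd_mul).1 (hdvd.trans (ρ.orderOf_dvd_two_mul x)) with h' | h'
  · rcases hG.prime_dvd _ p hp h' with h | h | ⟨rfl, h⟩ | ⟨rfl, h⟩
    · exact Or.inl h
    · exact Or.inr (Or.inl h)
    · have := ρ.orderOf_dvd_of_fixedPointFree x (hρ _ (Or.inl h))
      rw [h] at this
      exact Or.inr (Or.inr (Or.inl ⟨rfl, Nat.dvd_antisymm this hdvd⟩))
    · have := ρ.orderOf_dvd_of_fixedPointFree x (hρ _ (Or.inr h))
      rw [h] at this
      exact Or.inr (Or.inr (Or.inr ⟨rfl, Nat.dvd_antisymm this hdvd⟩))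
  · exact Or.inl ((Nat.prime_dvd_prime_iff_eq hp Nat.prime_two).1 h')

/-- The direct sum of `n` copies of a representation. -/
def Representation.copies (ρ : Representation K G V) (n : ℕ) : Representation K G (Fin n → V) where
  toFun g := (ρ g).compLeft (Fin n)
  map_one' := by ext; simp
  map_mul' g h := by ext; simp

theorem Representation.SevenThirteenFree.copies {ρ : Representation K G V}
    (hρ : ρ.SevenThirteenFree) (n : ℕ) : (ρ.copies n).SevenThirteenFree :=
  fun g hg v hv => funext fun i => hρ g hg (v i) (congrFun hv i)

theorem Representation.card_semidirectGroup_copies (ρ : Representation K G V) (n : ℕ) :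
    Nat.card (ρ.copies n).SemidirectGroup = Nat.card V ^ n * Nat.card G := by
  rw [SemidirectProduct.card]
  congr 1
  rw [Nat.card_congr Multiplicative.toAdd, Nat.card_fun, Nat.card_fin]

end Semidirect

theorem isUnrecognizable_of_representation {K G V : Type} [Field K] [CharP K 2] [Group G] [Finite G]
    [AddCommGroup V] [Module K V] [Finite V] [Nontrivial V] (ρ : Representation K G V)
    (hρ : ρ.SevenThirteenFree) (hG : HasEdgeTwoThree G) {G' : Type*} [Group G']
    (hG' : HasEdgeTwoThree G') : IsUnrecognizable G' := by
  refine ⟨fun n => (ρ.copies n).SemidirectGroup, fun n => inferInstance, fun n => ?_, fun n => ?_,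
    fun m n hmn => ⟨fun e => hmn ?_⟩⟩
  · exact Finite.of_equiv _ (SemidirectProduct.equivProd (φ := (ρ.copies n).toMulAutMultiplicative)).symm
  · exact ((hρ.copies n).hasEdgeTwoThree hG).gruenbergKegelGraph_eq hG'
  · have h := Nat.card_congr e.toEquiv
    rw [ρ.card_semidirectGroup_copies, ρ.card_semidirectGroup_copies] at h
    exact Nat.pow_right_injective Finite.one_lt_card (Nat.eq_of_mul_eq_mul_right Nat.card_pos h)

/-! ## Elements whose order is the full `p`-part of the group order -/

section Sylow

variable {G : Type*} [Group G] [Finite G] {p : ℕ}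

open scoped Pointwise in
-- Since `p` divides `|G|` exactly once, `⟨a⟩` and `⟨b⟩` are Sylow subgroups, hence conjugate.
theorem exists_conj_zpowers_eq (hp : p.Prime) (hcard : ¬ p ^ 2 ∣ Nat.card G) {a b : G}
    (ha : orderOf a = p) (hb : orderOf b = p) :
    ∃ c : G, b ∈ Subgroup.zpowers (c * a * c⁻¹) := by
  have := Fact.mk hp
  have hfac : (Nat.card G).factorization p = 1 := by
    refine le_antisymm ?_ ?_
    · by_contra! h
      exact hcard ((hp.pow_dvd_iff_le_factorization Nat.card_pos.ne').2 h)
    · exact (hp.dvd_iff_one_le_factorization Nat.card_pos.ne').1 (ha ▸ orderOf_dvd_natCard a)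
  have key : ∀ g : G, orderOf g = p →
      Nat.card (Subgroup.zpowers g) = p ^ (Nat.card G).factorization p := by
    intro g hg
    rw [Nat.card_zpowers, hg, hfac, pow_one]
  obtain ⟨c, hc⟩ := MulAction.exists_smul_eq G (Sylow.ofCard _ (key a ha)) (Sylow.ofCard _ (key b hb))
  have h1 : b ∈ MulAut.conj c • Subgroup.zpowers a := by
    rw [← Sylow.coe_ofCard _ (key a ha), ← Sylow.coe_subgroup_smul, hc]
    exact Subgroup.mem_zpowers b
  obtain ⟨_, ha', rfl⟩ := h1
  obtain ⟨k, rfl⟩ := Subgroup.mem_zpowers_iff.1 ha'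
  exact ⟨c, Subgroup.mem_zpowers_iff.2 ⟨k, by simp⟩⟩

/-- If `p` divides `|G|` only once and the centralizer of an element of order `p` is the group
generated by it, then `p` divides no other element order. -/
theorem orderOf_eq_of_prime_dvd (hp : p.Prime) (hcard : ¬ p ^ 2 ∣ Nat.card G) {b : G}
    (hb : orderOf b = p) (hcent : ∀ c : G, Commute c b → c ∈ Subgroup.zpowers b) (g : G)
    (hg : p ∣ orderOf g) : orderOf g = p := by
  have hn : orderOf g ≠ 0 := (orderOf_pos g).ne'
  obtain ⟨m, hm⟩ := hg
  have ha : orderOf (g ^ m) = p := by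
    rw [orderOf_pow_of_dvd (by rintro rfl; simp_all) ⟨p, by rw [hm, mul_comm]⟩, hm]
    exact Nat.mul_div_cancel _ (Nat.pos_of_ne_zero (by rintro rfl; simp_all))
  obtain ⟨c, hc⟩ := exists_conj_zpowers_eq hp hcard ha hb
  -- `b` is a power of the conjugate of `g ^ m`, hence of the conjugate of `g` itself.
  have hcomm : Commute (c * g * c⁻¹) b := by
    obtain ⟨k, rfl⟩ := Subgroup.mem_zpowers_iff.1 hc
    rw [← conj_pow]
    exact ((Commute.refl _).pow_right m).zpow_right k
  have h1 := Subgroup.mem_zpowers_iff.1 (hcent _ hcomm)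
  obtain ⟨k, hk⟩ := h1
  have h2 : orderOf g ∣ p := by
    have : orderOf (c * g * c⁻¹) = orderOf g := by
      simpa using (MulAut.conj c).orderOf_eq g
    rw [← this, ← hk, ← hb]
    exact orderOf_dvd_of_mem_zpowers (Subgroup.mem_zpowers_iff.2 ⟨k, rfl⟩)
  exact Nat.dvd_antisymm h2 ⟨m, hm⟩

end Sylow

/-! ## Element orders in `PSL(2, 13)` -/

namespace PSL2Thirteen

instance fact_prime_thirteen : Fact (Nat.Prime 13) := ⟨by norm_num⟩

/-- Cayley–Hamilton for `2 × 2` matrices of determinant one. -/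
theorem mul_self_eq (A : SL(2, ZMod 13)) : A.1 * A.1 = A.1.trace • A.1 - 1 := by
  have h := A.det_coe
  rw [Matrix.det_fin_two] at h
  ext i j
  fin_cases i <;> fin_cases j <;> simp [Matrix.mul_apply, Fin.sum_univ_two, Matrix.trace_fin_two]
  · linear_combination -h
  · ring
  · ring
  · linear_combination -h

/-- The coefficients of `A ^ n = x • A + y` for a matrix `A` of determinant one and trace `t`. -/
def powCoeff (t : ZMod 13) : ℕ → ZMod 13 × ZMod 13
  | 0 => (0, 1)
  | n + 1 => (t * (powCoeff t n).1 + (powCoeff t n).2, -(powCoeff t n).1)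

theorem pow_eq (A : SL(2, ZMod 13)) (n : ℕ) :
    A.1 ^ n = (powCoeff A.1.trace n).1 • A.1 + (powCoeff A.1.trace n).2 • 1 := by
  induction n with
  | zero => simp [powCoeff]
  | succ n ih =>
    rw [pow_succ, ih, add_mul, smul_mul_assoc, mul_self_eq, powCoeff]
    simp only [smul_sub, smul_smul, smul_mul_assoc, one_mul, add_smul, neg_smul]
    rw [mul_comm]
    abel

/-- The exponents are the orders `(13 - 1) / 2`, `(13 + 1) / 2` and `13` of the split torus, the
nonsplit torus and the unipotent subgroup of `PSL(2, 13)`. -/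
theorem powCoeff_cases : ∀ t : ZMod 13, ∃ c : ZMod 13, c ^ 2 = 1 ∧
    (powCoeff t 6 = (0, c) ∨ powCoeff t 7 = (0, c) ∨ powCoeff t 13 = (0, c)) := by decide

theorem mk_eq_one_iff (A : SL(2, ZMod 13)) :
    (QuotientGroup.mk A : PSL(2, ZMod 13)) = 1 ↔ ∃ c : ZMod 13, c ^ 2 = 1 ∧ A.1 = c • 1 := by
  rw [QuotientGroup.eq_one_iff, Matrix.SpecialLinearGroup.mem_center_iff]
  refine exists_congr fun c => and_congr (by simp) ?_
  rw [Matrix.scalar_apply, Matrix.smul_one_eq_diagonal, eq_comm]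

theorem pow_cases (g : PSL(2, ZMod 13)) : g ^ 6 = 1 ∨ g ^ 7 = 1 ∨ g ^ 13 = 1 := by
  obtain ⟨A, rfl⟩ := QuotientGroup.mk_surjective g
  have key : ∀ n (c : ZMod 13), c ^ 2 = 1 → powCoeff A.1.trace n = (0, c) →
      (QuotientGroup.mk A : PSL(2, ZMod 13)) ^ n = 1 := by
    intro n c hc h
    refine (mk_eq_one_iff (A ^ n)).2 ⟨c, hc, ?_⟩
    rw [Matrix.SpecialLinearGroup.coe_pow, pow_eq, h]
    simp
  obtain ⟨c, hc, h⟩ := powCoeff_cases A.1.trace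
  exact h.imp (key _ c hc) (Or.imp (key _ c hc) (key _ c hc))

theorem orderOf_mk {A : SL(2, ZMod 13)} {n : ℕ} (hn : 0 < n)
    (h : ∃ c : ZMod 13, c ^ 2 = 1 ∧ A.1 ^ n = c • 1)
    (h' : ∀ p : ℕ, p.Prime → p ∣ n → ¬ ∃ c : ZMod 13, c ^ 2 = 1 ∧ A.1 ^ (n / p) = c • 1) :
    orderOf (QuotientGroup.mk A : PSL(2, ZMod 13)) = n := by
  refine orderOf_eq_of_pow_and_pow_div_prime hn ((mk_eq_one_iff (A ^ n)).2 ?_)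
    fun p hp hd he => h' p hp hd ?_
  · rwa [Matrix.SpecialLinearGroup.coe_pow]
  · rw [← Matrix.SpecialLinearGroup.coe_pow]
    exact (mk_eq_one_iff (A ^ (n / p))).1 he

/-- A representative of an element of order `7` of `PSL(2, 13)`. -/
def seven : SL(2, ZMod 13) := ⟨!![3, -1; 1, 0], by decide⟩

/-- The upper unitriangular matrix. -/
def thirteen : SL(2, ZMod 13) := ⟨!![1, 1; 0, 1], by decide⟩

theorem orderOf_seven : orderOf (QuotientGroup.mk seven : PSL(2, ZMod 13)) = 7 := by
  refine orderOf_mk (by norm_num) (by decide) fun p hp hd => ?_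
  rw [(Nat.prime_dvd_prime_iff_eq hp (by norm_num)).1 hd]
  decide

theorem orderOf_thirteen : orderOf (QuotientGroup.mk thirteen : PSL(2, ZMod 13)) = 13 := by
  refine orderOf_mk (by norm_num) (by decide) fun p hp hd => ?_
  rw [(Nat.prime_dvd_prime_iff_eq hp (by norm_num)).1 hd]
  decide

theorem exists_orderOf_six : ∃ g : PSL(2, ZMod 13), orderOf g = 6 := by
  refine ⟨QuotientGroup.mk ⟨!![2, 0; 0, 7], by decide⟩,
    orderOf_mk (by norm_num) (by decide) fun p hp hd => ?_⟩
  rcases (Nat.Prime.dvd_mul hp).1 (show p ∣ 2 * 3 from hd) with h | h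
  · rw [(Nat.prime_dvd_prime_iff_eq hp (by norm_num)).1 h]
    decide
  · rw [(Nat.prime_dvd_prime_iff_eq hp (by norm_num)).1 h]
    decide

theorem hasEdgeTwoThree : HasEdgeTwoThree PSL(2, ZMod 13) where
  exists_six := exists_orderOf_six
  exists_seven := ⟨_, orderOf_seven⟩
  exists_thirteen := ⟨_, orderOf_thirteen⟩
  prime_dvd g p hp hd := by
    have key : ∀ q : ℕ, q.Prime → g ^ q = 1 → p = q ∧ orderOf g = q := by
      intro q hq hg
      have h := orderOf_dvd_of_pow_eq_one hg
      have hpq := (Nat.prime_dvd_prime_iff_eq hp hq).1 (hd.trans h)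
      exact ⟨hpq, Nat.dvd_antisymm h (hpq ▸ hd)⟩
    rcases pow_cases g with h | h | h
    · rcases (Nat.Prime.dvd_mul hp).1 (show p ∣ 2 * 3 from hd.trans (orderOf_dvd_of_pow_eq_one h))
        with h | h
      · exact Or.inl ((Nat.prime_dvd_prime_iff_eq hp (by norm_num)).1 h)
      · exact Or.inr (Or.inl ((Nat.prime_dvd_prime_iff_eq hp (by norm_num)).1 h))
    · exact Or.inr (Or.inr (Or.inl (key 7 (by norm_num) h)))
    · exact Or.inr (Or.inr (Or.inr (key 13 (by norm_num) h)))

/-- The bound is `|GL(2, 13)|`, which suffices to exclude the factors `7 ^ 2` and `13 ^ 2`. -/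
theorem card_dvd : Nat.card PSL(2, ZMod 13) ∣ 2 ^ 5 * 3 ^ 2 * 7 * 13 := by
  have h1 := Subgroup.card_eq_card_quotient_mul_card_subgroup (Subgroup.center SL(2, ZMod 13))
  have h2 : Nat.card SL(2, ZMod 13) ∣ Nat.card (GL (Fin 2) (ZMod 13)) :=
    Subgroup.card_dvd_of_injective Matrix.SpecialLinearGroup.toGL
      Matrix.SpecialLinearGroup.toGL_injective
  rw [Matrix.card_GL_field, Fin.prod_univ_two, ZMod.card] at h2
  exact (Dvd.intro _ h1.symm).trans (h2.trans (by norm_num))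

/-- Elements of `PSL(2, 13)` of order `7` or `13` act fixed-point-freely on a module as soon as one
element of each of these orders does. -/
theorem sevenThirteenFree_of {K V : Type*} [Field K] [AddCommGroup V] [Module K V]
    (ρ : Representation K PSL(2, ZMod 13) V)
    (h7 : ∀ v, ρ (QuotientGroup.mk seven) v = v → v = 0)
    (h13 : ∀ v, ρ (QuotientGroup.mk thirteen) v = v → v = 0) : ρ.SevenThirteenFree := by
  have key : ∀ (p : ℕ) (b : PSL(2, ZMod 13)), p.Prime →
      ¬ p ^ 2 ∣ Nat.card PSL(2, ZMod 13) → orderOf b = p → (∀ v, ρ b v = v → v = 0) →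
      ∀ g, orderOf g = p → ∀ v, ρ g v = v → v = 0 := by
    intro p b hp hcard hb hfree g hg v hv
    obtain ⟨c, hc⟩ := exists_conj_zpowers_eq hp hcard hg hb
    obtain ⟨k, rfl⟩ := mem_powers_iff_mem_zpowers.2 hc
    -- A fixed vector `v` of `g` yields the fixed vector `ρ c v` of the conjugate, hence of its
    -- power `b`.
    have hfix : Function.IsFixedPt (ρ (c * g * c⁻¹)) (ρ c v) := by
      change ρ (c * g * c⁻¹) (ρ c v) = ρ c v
      rw [← Module.End.mul_apply, ← map_mul, inv_mul_cancel_right, map_mul, Module.End.mul_apply, hv]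
    have h0 : ρ c v = 0 := by
      refine hfree _ ?_
      simp only [map_pow, Module.End.pow_apply]
      exact hfix.iterate k
    rw [← ρ.inv_self_apply c v, h0, map_zero]
  rintro g (hg | hg)
  · exact key 7 _ (by norm_num) (fun h => by have := h.trans card_dvd; norm_num at this)
      orderOf_seven h7 g hg
  · exact key 13 _ (by norm_num) (fun h => by have := h.trans card_dvd; norm_num at this)
      orderOf_thirteen h13 g hg

end PSL2Thirteen

/-! ## Homomorphisms out of `SL(2, F)` from the Bruhat decomposition -/

/-- Images in a monoid of the upper unitriangular matrices, of the diagonal matrices and of the Weyl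
element of `SL(2, F)`, subject to the relations that define `SL(2, F)`. -/
structure BruhatData (F M : Type*) [Field F] [Monoid M] where
  /-- The image of `!![1, x; 0, 1]`. -/
  T : F → M
  /-- The image of `!![a, 0; 0, a⁻¹]`. -/
  D : F → M
  /-- The image of `!![0, -1; 1, 0]`. -/
  S : M
  T_zero : T 0 = 1
  T_add : ∀ x y, T (x + y) = T x * T y
  D_one : D 1 = 1
  D_mul : ∀ a b, a ≠ 0 → b ≠ 0 → D (a * b) = D a * D b
  D_mul_T : ∀ a x, a ≠ 0 → D a * T x = T (a ^ 2 * x) * D a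
  S_mul_D : ∀ a, a ≠ 0 → S * D a = D a⁻¹ * S
  S_mul_S : S * S = D (-1)
  S_mul_T_mul_S : ∀ x, x ≠ 0 → S * T x * S = T (-x⁻¹) * S * D x * T (-x⁻¹)

namespace BruhatData

variable {F M : Type*} [Field F] [Monoid M] (B : BruhatData F M)

open Classical in
/-- The value of the homomorphism on a matrix. -/
noncomputable def toFun (A : SL(2, F)) : M :=
  -- For rows `(a, b)`, `(c, d)` the matrix is `T(ab) D(a)` in the Borel subgroup (`c = 0`) and
  -- `T(a/c) S D(c) T(d/c)` in the big cell.
  if A 1 0 = 0 then B.T (A 0 1 * A 0 0) * B.D (A 0 0)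
  else B.T (A 0 0 / A 1 0) * B.S * B.D (A 1 0) * B.T (A 1 1 / A 1 0)

theorem toFun_of_eq (A : SL(2, F)) (h : A 1 0 = 0) :
    B.toFun A = B.T (A 0 1 * A 0 0) * B.D (A 0 0) := if_pos h

theorem toFun_of_ne (A : SL(2, F)) (h : A 1 0 ≠ 0) :
    B.toFun A = B.T (A 0 0 / A 1 0) * B.S * B.D (A 1 0) * B.T (A 1 1 / A 1 0) := if_neg h

theorem toFun_one : B.toFun 1 = 1 := by
  rw [toFun_of_eq _ _ (by simp)]
  simp [B.T_zero, B.D_one]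

/-- These variants rewrite the head of a right-associated word, so that products can be brought to
Bruhat normal form. -/
theorem T_mul_T_assoc (x y : F) (m : M) : B.T x * (B.T y * m) = B.T (x + y) * m := by
  rw [B.T_add, mul_assoc]

theorem D_mul_T_assoc {a : F} (ha : a ≠ 0) (x : F) (m : M) :
    B.D a * (B.T x * m) = B.T (a ^ 2 * x) * (B.D a * m) := by
  rw [← mul_assoc, B.D_mul_T a x ha, mul_assoc]

theorem D_mul_D_assoc {a b : F} (ha : a ≠ 0) (hb : b ≠ 0) (m : M) :
    B.D a * (B.D b * m) = B.D (a * b) * m := by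
  rw [B.D_mul a b ha hb, mul_assoc]

theorem D_mul_S_assoc {a : F} (ha : a ≠ 0) (m : M) : B.D a * (B.S * m) = B.S * (B.D a⁻¹ * m) := by
  rw [← mul_assoc, ← mul_assoc, B.S_mul_D _ (inv_ne_zero ha), inv_inv]

theorem T_mul_D_assoc {a : F} (ha : a ≠ 0) (x : F) (m : M) :
    B.T x * (B.D a * m) = B.D a * (B.T (x / a ^ 2) * m) := by
  rw [B.D_mul_T_assoc ha, mul_div_cancel₀ _ (pow_ne_zero 2 ha)]

theorem T_mul_D {a : F} (ha : a ≠ 0) (x : F) : B.T x * B.D a = B.D a * B.T (x / a ^ 2) := by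
  rw [B.D_mul_T _ _ ha, mul_div_cancel₀ _ (pow_ne_zero 2 ha)]

theorem S_mul_T_mul_S_assoc {x : F} (hx : x ≠ 0) (m : M) :
    B.S * (B.T x * (B.S * m)) = B.T (-x⁻¹) * (B.S * (B.D x * (B.T (-x⁻¹) * m))) := by
  simp only [← mul_assoc]
  rw [B.S_mul_T_mul_S x hx]

/-- The products of normal forms. Two big-cell factors land in the Borel subgroup or in the big cell
according as the inner unipotent part `v + u'` vanishes or not. -/
theorem TD_mul_TD {a b : F} (ha : a ≠ 0) (hb : b ≠ 0) (u v : F) :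
    B.T u * B.D a * (B.T v * B.D b) = B.T (u + a ^ 2 * v) * B.D (a * b) := by
  rw [mul_assoc, B.D_mul_T_assoc ha, B.T_mul_T_assoc, B.D_mul a b ha hb]

theorem TD_mul_TSDT {a c : F} (ha : a ≠ 0) (hc : c ≠ 0) (u v w : F) :
    B.T u * B.D a * (B.T v * B.S * B.D c * B.T w) =
      B.T (u + a ^ 2 * v) * B.S * B.D (a⁻¹ * c) * B.T w := by
  simp only [mul_assoc]
  rw [B.D_mul_T_assoc ha, B.T_mul_T_assoc, B.D_mul_S_assoc ha, B.D_mul_D_assoc (inv_ne_zero ha) hc]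

theorem TSDT_mul_TD {b c : F} (hb : b ≠ 0) (hc : c ≠ 0) (u v w : F) :
    B.T u * B.S * B.D c * B.T v * (B.T w * B.D b) =
      B.T u * B.S * B.D (c * b) * B.T ((v + w) / b ^ 2) := by
  simp only [mul_assoc]
  rw [B.T_mul_T_assoc, B.T_mul_D hb, B.D_mul_D_assoc hc hb]

theorem TSDT_mul_TSDT_of_eq {c c' : F} (hc : c ≠ 0) (hc' : c' ≠ 0) (u u' v v' : F) (h : v + u' = 0) :
    B.T u * B.S * B.D c * B.T v * (B.T u' * B.S * B.D c' * B.T v') =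
      B.T (u + (-1 * (c⁻¹ * c')) ^ 2 * v') * B.D (-1 * (c⁻¹ * c')) := by
  have hne : c⁻¹ * c' ≠ 0 := mul_ne_zero (inv_ne_zero hc) hc'
  simp only [mul_assoc]
  rw [B.T_mul_T_assoc, h, B.T_zero, one_mul, B.D_mul_S_assoc hc, ← mul_assoc B.S B.S, B.S_mul_S,
    B.D_mul_D_assoc (inv_ne_zero hc) hc', B.D_mul_D_assoc (neg_ne_zero.2 one_ne_zero) hne,
    B.D_mul_T _ _ (mul_ne_zero (neg_ne_zero.2 one_ne_zero) hne), B.T_mul_T_assoc]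

theorem TSDT_mul_TSDT_of_ne {c c' : F} (hc : c ≠ 0) (hc' : c' ≠ 0) (u u' v v' : F)
    (h : v + u' ≠ 0) :
    B.T u * B.S * B.D c * B.T v * (B.T u' * B.S * B.D c' * B.T v') =
      B.T (u + -(c ^ 2 * (v + u'))⁻¹) * B.S * B.D (c ^ 2 * (v + u') * (c⁻¹ * c')) *
        B.T (-(c ^ 2 * (v + u'))⁻¹ / (c⁻¹ * c') ^ 2 + v') := by
  have hne : c⁻¹ * c' ≠ 0 := mul_ne_zero (inv_ne_zero hc) hc'
  have hx : c ^ 2 * (v + u') ≠ 0 := mul_ne_zero (pow_ne_zero 2 hc) h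
  simp only [mul_assoc (B.T _), mul_assoc B.S, mul_assoc (B.D _)]
  rw [B.T_mul_T_assoc, B.D_mul_T_assoc hc, B.D_mul_S_assoc hc,
    B.D_mul_D_assoc (inv_ne_zero hc) hc', B.S_mul_T_mul_S_assoc hx, B.T_mul_T_assoc,
    B.T_mul_D_assoc hne, B.D_mul_D_assoc hx hne, ← B.T_add]

theorem toFun_mul (A A' : SL(2, F)) : B.toFun (A * A') = B.toFun A * B.toFun A' := by
  have hA : A 0 0 * A 1 1 - A 0 1 * A 1 0 = 1 := by rw [← Matrix.det_fin_two]; exact A.det_coe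
  have hA' : A' 0 0 * A' 1 1 - A' 0 1 * A' 1 0 = 1 := by
    rw [← Matrix.det_fin_two]; exact A'.det_coe
  have h00 : (A * A') 0 0 = A 0 0 * A' 0 0 + A 0 1 * A' 1 0 := by
    simp [Matrix.mul_apply, Fin.sum_univ_two]
  have h01 : (A * A') 0 1 = A 0 0 * A' 0 1 + A 0 1 * A' 1 1 := by
    simp [Matrix.mul_apply, Fin.sum_univ_two]
  have h10 : (A * A') 1 0 = A 1 0 * A' 0 0 + A 1 1 * A' 1 0 := by
    simp [Matrix.mul_apply, Fin.sum_univ_two]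
  have h11 : (A * A') 1 1 = A 1 0 * A' 0 1 + A 1 1 * A' 1 1 := by
    simp [Matrix.mul_apply, Fin.sum_univ_two]
  by_cases hc : A 1 0 = 0 <;> by_cases hc' : A' 1 0 = 0
  · have ha : A 0 0 ≠ 0 := fun h => by simp [h, hc] at hA
    have ha' : A' 0 0 ≠ 0 := fun h => by simp [h, hc'] at hA'
    have h : (A * A') 1 0 = 0 := by rw [h10, hc, hc']; ring
    rw [toFun_of_eq _ _ hc, toFun_of_eq _ _ hc', toFun_of_eq _ _ h, B.TD_mul_TD ha ha', h00, h01,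
      hc', mul_zero, add_zero]
    congr 2
    linear_combination A 0 1 * A 0 0 * hA' + A 0 1 * A 0 0 * A' 0 1 * hc'
  · have ha : A 0 0 ≠ 0 := fun h => by simp [h, hc] at hA
    have hd : A 1 1 = (A 0 0)⁻¹ := by
      rw [hc] at hA
      field_simp
      linear_combination hA
    have h : (A * A') 1 0 ≠ 0 := by
      rw [h10, hc, zero_mul, zero_add, hd]
      exact mul_ne_zero (inv_ne_zero ha) hc'
    rw [toFun_of_eq _ _ hc, toFun_of_ne _ _ hc', toFun_of_ne _ _ h, B.TD_mul_TSDT ha hc', h00, h10,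
      h11, hc, hd]
    simp only [zero_mul, zero_add]
    congr 2
    · congr 2
      field_simp
      ring
    · field_simp
  · have ha' : A' 0 0 ≠ 0 := fun h => by simp [h, hc'] at hA'
    have hd : A' 1 1 = (A' 0 0)⁻¹ := by
      rw [hc'] at hA'
      field_simp
      linear_combination hA'
    have h : (A * A') 1 0 ≠ 0 := by
      rw [h10, hc', mul_zero, add_zero]
      exact mul_ne_zero hc ha'
    rw [toFun_of_ne _ _ hc, toFun_of_eq _ _ hc', toFun_of_ne _ _ h, B.TSDT_mul_TD ha' hc, h00, h10,
      h11, hc', hd]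
    simp only [mul_zero, add_zero]
    rw [mul_div_mul_right _ _ ha']
    congr 2
    field_simp
    ring
  -- The determinant eliminates the upper right entries; what remains are rational identities.
  · have hb : A 0 1 = (A 0 0 * A 1 1 - 1) / A 1 0 := by
      field_simp
      linear_combination -hA
    have hb' : A' 0 1 = (A' 0 0 * A' 1 1 - 1) / A' 1 0 := by
      field_simp
      linear_combination -hA'
    -- The lower left entry of the product vanishes exactly when the inner unipotent part does.
    have hw : (A * A') 1 0 = A 1 0 * A' 1 0 * (A 1 1 / A 1 0 + A' 0 0 / A' 1 0) := by
      rw [h10]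
      field_simp
      ring
    by_cases h : A 1 1 / A 1 0 + A' 0 0 / A' 1 0 = 0
    · have ha' : A' 0 0 = -(A 1 1 / A 1 0) * A' 1 0 := by
        field_simp at h ⊢
        linear_combination h
      rw [toFun_of_ne _ _ hc, toFun_of_ne _ _ hc', toFun_of_eq _ _ (by rw [hw, h, mul_zero]),
        B.TSDT_mul_TSDT_of_eq hc hc' _ _ _ _ h, h00, h01, hb, hb', ha']
      congr 2
      · field_simp
        ring
      · field_simp
        ring
    · have hP : (A * A') 1 0 ≠ 0 := by
        rw [hw]
        exact mul_ne_zero (mul_ne_zero hc hc') h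
      rw [toFun_of_ne _ _ hc, toFun_of_ne _ _ hc', toFun_of_ne _ _ hP,
        B.TSDT_mul_TSDT_of_ne hc hc' _ _ _ _ h]
      generalize hσ : A 1 1 / A 1 0 + A' 0 0 / A' 1 0 = σ at *
      have ha' : A' 0 0 = (σ - A 1 1 / A 1 0) * A' 1 0 := by
        rw [← hσ]
        field_simp
        ring
      have e0 : (A * A') 0 0 / (A * A') 1 0 = A 0 0 / A 1 0 + -(A 1 0 ^ 2 * σ)⁻¹ := by
        rw [hw, h00, hb, ha']
        field_simp
        ring
      have e1 : (A * A') 1 1 / (A * A') 1 0 =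
          -(A 1 0 ^ 2 * σ)⁻¹ / ((A 1 0)⁻¹ * A' 1 0) ^ 2 + A' 1 1 / A' 1 0 := by
        rw [hw, h11, hb', ha']
        field_simp
        ring
      have e2 : (A * A') 1 0 = A 1 0 ^ 2 * σ * ((A 1 0)⁻¹ * A' 1 0) := by
        rw [hw]
        field_simp
      rw [e0, e1, ← e2]

/-- The homomorphism from `SL(2, F)` given by the images of its generators. -/
noncomputable def toMonoidHom : SL(2, F) →* M where
  toFun := B.toFun
  map_one' := B.toFun_one
  map_mul' := B.toFun_mul

end BruhatData

/-! ## The field with four elements -/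

/-- The field with four elements; `(a, b)` stands for `a + b w`, where `w ^ 2 = w + 1`. -/
def FieldFour : Type := Bool × Bool

namespace FieldFour

instance : DecidableEq FieldFour := inferInstanceAs (DecidableEq (Bool × Bool))
instance : Fintype FieldFour := inferInstanceAs (Fintype (Bool × Bool))
instance : Zero FieldFour := ⟨(false, false)⟩
instance : One FieldFour := ⟨(true, false)⟩
instance : Add FieldFour := ⟨fun x y => (xor x.1 y.1, xor x.2 y.2)⟩
instance : Mul FieldFour :=
  ⟨fun x y => (xor (x.1 && y.1) (x.2 && y.2),
    xor (xor (x.1 && y.2) (x.2 && y.1)) (x.2 && y.2))⟩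
instance : Neg FieldFour := ⟨id⟩
-- Inversion is squaring, because `x ^ 3 = 1` for `x ≠ 0`; zero goes to zero.
instance : Inv FieldFour := ⟨fun x => (xor x.1 x.2, x.2)⟩

instance : Field FieldFour where
  add_assoc := by decide
  zero_add := by decide
  add_zero := by decide
  add_comm := by decide
  left_distrib := by decide
  right_distrib := by decide
  zero_mul := by decide
  mul_zero := by decide
  mul_assoc := by decide
  one_mul := by decide
  mul_one := by decide
  mul_comm := by decide
  neg_add_cancel := by decide
  exists_pair_ne := ⟨0, 1, by decide⟩
  mul_inv_cancel := by decide
  inv_zero := by decide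
  nsmul := nsmulRec
  zsmul := zsmulRec
  nnqsmul := _
  qsmul := _

instance : CharP FieldFour 2 := CharTwo.of_one_ne_zero_of_two_eq_zero (by decide) (by decide)

theorem card : Nat.card FieldFour = 4 := by rw [Nat.card_eq_fintype_card]; rfl

/-- A primitive cube root of unity. -/
def w : FieldFour := (false, true)

/-- The other primitive cube root of unity. -/
def w2 : FieldFour := (true, true)

end FieldFour

namespace PSL2Thirteen

/-! ## Homomorphisms out of `SL(2, 13)` -/

/-- The logarithm to base `2` modulo `13`, reduced modulo `6`. -/
def dlog : ZMod 13 → ℕ := ![0, 0, 1, 4, 2, 3, 5, 5, 3, 2, 4, 1, 0]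

/-- The logarithm of `-1` is `6`, so working modulo `6` makes `-1` act trivially, as it must for
`PSL(2, 13)`. The value `dlog 0 = 0` is a default. -/
theorem dlog_mul : ∀ a b : ZMod 13, a ≠ 0 → b ≠ 0 → dlog (a * b) = (dlog a + dlog b) % 6 := by
  decide

theorem dlog_inv : ∀ a : ZMod 13, a ≠ 0 → dlog a⁻¹ = 5 * dlog a % 6 := by
  have h : ∀ a b : ZMod 13, a * b = 1 → dlog b = 5 * dlog a % 6 := by decide
  exact fun a ha => h a a⁻¹ (mul_inv_cancel₀ ha)

theorem four_pow_dlog : ∀ a x : ZMod 13, a ≠ 0 → (a ^ 2 * x).val = 4 ^ dlog a * x.val % 13 := by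
  decide

/-- `2` is not a square modulo `13`. Conjugation by the torus multiplies `x` by squares, so the
relation for `S T(x) S` is needed only at `x = 1` and `x = 2`. -/
theorem exists_sq : ∀ x : ZMod 13, x ≠ 0 → ∃ a, a ≠ 0 ∧ (x = a ^ 2 * 1 ∨ x = a ^ 2 * 2) := by decide

/-- Relations that define `PSL(2, 13)`, for the images of `!![1, 1; 0, 1]`, `!![2, 0; 0, 7]` and
`!![0, -1; 1, 0]`, yield a homomorphism. -/
def bruhatData {M : Type*} [Monoid M] (t d s : M) (ht : t ^ 13 = 1) (hd : d ^ 6 = 1)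
    (hs : s * s = 1) (hdt : d * t = t ^ 4 * d) (hds : d * s * d = s)
    (h1 : s * t * s = t ^ 12 * s * t ^ 12) (h2 : s * t ^ 2 * s = t ^ 6 * s * d * t ^ 6) :
    BruhatData (ZMod 13) M :=
  have T_add : ∀ x y : ZMod 13, t ^ (x + y).val = t ^ x.val * t ^ y.val := fun x y => by
    rw [ZMod.val_add, ← pow_eq_pow_mod _ ht, pow_add]
  have D_mul : ∀ a b : ZMod 13, a ≠ 0 → b ≠ 0 → d ^ dlog (a * b) = d ^ dlog a * d ^ dlog b :=
    fun a b ha hb => by rw [dlog_mul a b ha hb, ← pow_eq_pow_mod _ hd, pow_add]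
  have D_mul_T : ∀ a x : ZMod 13, a ≠ 0 →
      d ^ dlog a * t ^ x.val = t ^ (a ^ 2 * x).val * d ^ dlog a := fun a x ha => by
    have h : ∀ k n, d ^ k * t ^ n = t ^ (4 ^ k * n) * d ^ k := by
      have h' : ∀ n, d * t ^ n = t ^ (4 * n) * d := fun n => by
        rw [pow_mul]
        exact SemiconjBy.pow_right hdt n
      intro k
      induction k with
      | zero => simp
      | succ k ih =>
        intro n
        rw [pow_succ, mul_assoc, h', ← mul_assoc, ih, mul_assoc, pow_succ, mul_assoc]
    rw [h, four_pow_dlog a x ha, ← pow_eq_pow_mod _ ht]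
  have S_mul_D : ∀ a : ZMod 13, a ≠ 0 → s * d ^ dlog a = d ^ dlog a⁻¹ * s := fun a ha => by
    have h : s * d = d ^ 5 * s := by
      conv_rhs => rw [← hds, ← mul_assoc, ← mul_assoc, ← pow_succ, hd, one_mul]
    rw [dlog_inv a ha, ← pow_eq_pow_mod _ hd, pow_mul]
    exact SemiconjBy.pow_right h _
  { T := fun x => t ^ x.val
    D := fun a => d ^ dlog a
    S := s
    T_zero := pow_zero t
    T_add := T_add
    D_one := pow_zero d
    D_mul := D_mul
    D_mul_T := D_mul_T
    S_mul_D := S_mul_D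
    S_mul_S := hs.trans (pow_zero d).symm
    S_mul_T_mul_S := fun x hx => by
      -- Moving `d ^ dlog a` through the relation at `x` gives the relation at `a ^ 2 * x`.
      have key : ∀ a x : ZMod 13, a ≠ 0 → x ≠ 0 →
          s * t ^ x.val * s = t ^ (-x⁻¹).val * s * d ^ dlog x * t ^ (-x⁻¹).val →
          s * t ^ (a ^ 2 * x).val * s =
            t ^ (-(a ^ 2 * x)⁻¹).val * s * d ^ dlog (a ^ 2 * x) * t ^ (-(a ^ 2 * x)⁻¹).val := by
        intro a x ha hx h
        have ha' := inv_ne_zero ha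
        have e : a⁻¹ ^ 2 * -x⁻¹ = -(a ^ 2 * x)⁻¹ := by field_simp
        have e' : a ^ 2 * -(a ^ 2 * x)⁻¹ = -x⁻¹ := by field_simp
        have hDD : d ^ dlog a * d ^ dlog a⁻¹ = 1 := by
          rw [← D_mul _ _ ha ha', mul_inv_cancel₀ ha]
          exact pow_zero d
        calc s * t ^ (a ^ 2 * x).val * s
            = s * t ^ (a ^ 2 * x).val * (d ^ dlog a * d ^ dlog a⁻¹) * s := by rw [hDD, mul_one]
          _ = s * (t ^ (a ^ 2 * x).val * d ^ dlog a) * (d ^ dlog a⁻¹ * s) := by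
            simp only [mul_assoc]
          _ = (s * d ^ dlog a) * t ^ x.val * (s * d ^ dlog a) := by
            rw [← D_mul_T a x ha, ← S_mul_D a ha]; simp only [mul_assoc]
          _ = d ^ dlog a⁻¹ * (s * t ^ x.val * s) * d ^ dlog a := by
            rw [S_mul_D a ha]; simp only [mul_assoc]; rw [S_mul_D a ha]
          _ = (d ^ dlog a⁻¹ * t ^ (-x⁻¹).val) * s * d ^ dlog x * (t ^ (-x⁻¹).val * d ^ dlog a) := by
            rw [h]; simp only [mul_assoc]
          _ = t ^ (-(a ^ 2 * x)⁻¹).val * (d ^ dlog a⁻¹ * s) * d ^ dlog x *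
              (d ^ dlog a * t ^ (-(a ^ 2 * x)⁻¹).val) := by
            rw [D_mul_T _ _ ha', e, D_mul_T _ _ ha, e']; simp only [mul_assoc]
          _ = _ := by
            rw [← S_mul_D a ha, show a ^ 2 * x = a * (x * a) by ring,
              D_mul _ _ ha (mul_ne_zero hx ha), D_mul _ _ hx ha]
            simp only [mul_assoc]
      obtain ⟨a, ha, rfl | rfl⟩ := exists_sq x hx
      · refine key a 1 ha one_ne_zero ?_
        rw [show (-(1 : ZMod 13)⁻¹).val = 12 by rw [inv_one]; decide, show (1 : ZMod 13).val = 1 by decide,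
          show dlog 1 = 0 by decide, pow_one, pow_zero, mul_one, h1]
      · refine key a 2 ha (by decide) ?_
        rw [show (-(2 : ZMod 13)⁻¹).val = 6 by
          rw [inv_eq_of_mul_eq_one_right (show (2 : ZMod 13) * 7 = 1 by decide)]; decide, show (2 : ZMod 13).val = 2 by decide,
          show dlog 2 = 1 by decide, pow_one, h2] }

/-! ## A six-dimensional module over the field with four elements -/

open FieldFour

/-- The action of `!![1, 1; 0, 1]`. -/
def matT : Matrix (Fin 6) (Fin 6) FieldFour :=
  !![0, 0, 0, 0, 0, 1; 1, 0, 0, 0, 0, w2; 0, 1, 0, 0, 0, 0; 0, 0, 1, 0, 0, w; 0, 0, 0, 1, 0, 0;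
    0, 0, 0, 0, 1, w2]

/-- The action of `!![2, 0; 0, 7]`. -/
def matD : Matrix (Fin 6) (Fin 6) FieldFour :=
  !![1, 0, 0, 0, 0, 0; w2, 0, 0, 1, w2, w; 1, w2, w, 0, 1, w2; w, 1, w2, 1, w2, 1;
    1, w2, 1, 0, w, w2; w2, w, w2, 1, 0, 0]

/-- The action of `!![0, -1; 1, 0]`. -/
def matS : Matrix (Fin 6) (Fin 6) FieldFour :=
  !![1, 0, 0, 0, 0, 0; w, 0, 0, 0, 0, 1; 1, w, w2, w2, w, 0; 1, w, 0, 1, 0, w; 1, 0, w, w2, w2, w;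
    w, 1, 0, 0, 0, 0]

/-- `matT` is the companion matrix of a factor of degree `6` of the cyclotomic polynomial `Φ₁₃`. Its
powers are tabulated to keep each evaluation short. -/
theorem matT_sq : matT ^ 2 = !![0, 0, 0, 0, 1, w2; 0, 0, 0, 0, w2, w2; 1, 0, 0, 0, 0, w2;
    0, 1, 0, 0, w, 1; 0, 0, 1, 0, 0, w; 0, 0, 0, 1, w2, w] := by
  rw [pow_two]; decide +kernel

theorem matT_pow_six : matT ^ (2 * 3) = !![1, w2, w, w2, w2, w; w2, w2, w, 0, 1, w; 0, w2, w2, w, 0, 1;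
    w, 1, 0, w, w2, w2; 0, w, 1, 0, w, w2; w2, w, w2, w2, w, w2] := by
  rw [pow_mul matT 2 3, matT_sq, pow_three]; decide +kernel

theorem matT_pow_twelve : matT ^ (6 * 2) = !![w2, 1, 0, 0, 0, 0; 0, 0, 1, 0, 0, 0; w, 0, 0, 1, 0, 0;
    0, 0, 0, 0, 1, 0; w2, 0, 0, 0, 0, 1; 1, 0, 0, 0, 0, 0] := by
  rw [pow_mul, show matT ^ 6 = _ from matT_pow_six, pow_two]; decide +kernel

theorem matD_pow_three : matD ^ 3 = !![1, 0, 0, 0, 0, 0; w2, 0, 0, 0, 0, 1; 0, 0, 0, 0, 1, 0;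
    w, 0, 0, 1, 0, 0; 0, 0, 1, 0, 0, 0; w2, 1, 0, 0, 0, 0] := by
  rw [pow_three]; decide +kernel

/-- The homomorphism from `SL(2, 13)` to matrices. -/
noncomputable def toMatrix : SL(2, ZMod 13) →* Matrix (Fin 6) (Fin 6) FieldFour :=
  (bruhatData matT matD matS
    (by rw [pow_succ, show matT ^ 12 = _ from matT_pow_twelve]; decide +kernel)
    (by rw [show matD ^ 6 = (matD ^ 3) ^ 2 from pow_mul matD 3 2, matD_pow_three, pow_two]
        decide +kernel)
    (by decide +kernel)
    (by rw [show matT ^ 4 = (matT ^ 2) ^ 2 from pow_mul matT 2 2, matT_sq, pow_two]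
        decide +kernel)
    (by decide +kernel)
    (by rw [show matT ^ 12 = _ from matT_pow_twelve]; decide +kernel)
    (by rw [show matT ^ 6 = _ from matT_pow_six, matT_sq]; decide +kernel)).toMonoidHom

theorem toMatrix_thirteen : toMatrix thirteen = matT := by
  refine (BruhatData.toFun_of_eq _ thirteen rfl).trans ?_
  change matT ^ 1 * matD ^ 0 = matT
  simp

theorem toMatrix_seven : toMatrix seven = matT ^ 3 * matS := by
  refine (BruhatData.toFun_of_ne _ seven (by decide)).trans ?_
  change matT ^ ((3 : ZMod 13) / 1).val * matS * matD ^ 0 * matT ^ ((0 : ZMod 13) / 1).val = _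
  rw [div_one, div_one, show (3 : ZMod 13).val = 3 by decide, ZMod.val_zero]
  simp

/-- Central elements are the scalars `1` and `-1`, and `dlog` vanishes at both. -/
theorem toMatrix_of_mem_center {A : SL(2, ZMod 13)} (hA : A ∈ Subgroup.center SL(2, ZMod 13)) :
    toMatrix A = 1 := by
  obtain ⟨c, hc, h⟩ := (mk_eq_one_iff A).1 ((QuotientGroup.eq_one_iff A).2 hA)
  refine (BruhatData.toFun_of_eq _ A (by simp [h])).trans ?_
  rw [h]
  change matT ^ ((c • (1 : Matrix (Fin 2) (Fin 2) (ZMod 13))) 0 1 * _).val *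
    matD ^ dlog ((c • (1 : Matrix (Fin 2) (Fin 2) (ZMod 13))) 0 0) = 1
  have hd : ∀ c : ZMod 13, c ^ 2 = 1 → dlog c = 0 := by decide
  simp [hd c hc]

/-! ### The representation: fixed points and irreducibility -/

/-- The representation of `PSL(2, 13)`. -/
noncomputable def rep : Representation FieldFour PSL(2, ZMod 13) (Fin 6 → FieldFour) :=
  QuotientGroup.lift (Subgroup.center SL(2, ZMod 13))
    ((Matrix.toLinAlgEquiv' (R := FieldFour) (n := Fin 6)).toMonoidHom.comp toMatrix)
    fun A hA => by
      change Matrix.toLinAlgEquiv' (toMatrix A) = 1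
      rw [toMatrix_of_mem_center hA, map_one]

theorem rep_mk (A : SL(2, ZMod 13)) (v : Fin 6 → FieldFour) :
    rep (QuotientGroup.mk A) v = (toMatrix A).mulVec v := rfl

theorem eq_zero_of_left_inverse {A N : Matrix (Fin 6) (Fin 6) FieldFour} (h : N * (A - 1) = 1)
    {v : Fin 6 → FieldFour} (hv : A.mulVec v = v) : v = 0 := by
  rw [← Matrix.one_mulVec v, ← h, ← Matrix.mulVec_mulVec, Matrix.sub_mulVec, hv, Matrix.one_mulVec,
    sub_self, Matrix.mulVec_zero]

theorem rep_sevenThirteenFree : rep.SevenThirteenFree := by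
  refine sevenThirteenFree_of rep (fun v hv => ?_) (fun v hv => ?_)
  · rw [rep_mk, toMatrix_seven] at hv
    -- `N` is the explicit inverse of `matT ^ 3 * matS - 1`.
    refine eq_zero_of_left_inverse (N := !![w, w2, 1, 1, 1, 1; w, 1, w2, 0, 1, 0; 1, 1, 0, 0, w, 0;
      0, w, 0, w2, 1, w; w, 1, 1, 0, 1, w2; 1, w2, w2, w2, 1, 0]) ?_ hv
    have h : matT ^ 3 * matS = !![1, 0, 1, w2, w, w2; w2, w2, 1, 1, w, 0; w, w2, 1, w, w, 1;
      w, w2, w, 1, w2, 1; w, 1, w2, 1, 1, w; 1, 0, 0, 1, w2, w] := by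
      rw [pow_succ, matT_sq]; decide +kernel
    rw [h]
    decide +kernel
  · rw [rep_mk, toMatrix_thirteen] at hv
    refine eq_zero_of_left_inverse (N := !![w, w2, w2, w2, w2, w2; 0, 0, 1, 1, 1, 1;
      0, 0, 0, 1, 1, 1; 1, 1, 1, 1, 0, 0; 1, 1, 1, 1, 1, 0; w2, w2, w2, w2, w2, w2]) ?_ hv
    decide +kernel

/-- An element of order `13` fixes only zero in an invariant subspace of dimension `k`, so `4 ^ k ≡
1` modulo `13`. As `4` has order `6`, `k` is `0` or `6`. -/
theorem rep_isIrreducible : rep.IsIrreducible := by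
  refine { toNontrivial := ⟨⊥, ⊤, fun h => ?_⟩, eq_bot_or_eq_top := fun W => ?_ }
  · exact bot_ne_top (α := Submodule FieldFour (Fin 6 → FieldFour))
      (congrArg Subrepresentation.toSubmodule h)
  let g : PSL(2, ZMod 13) := QuotientGroup.mk thirteen
  let f : Function.End W.toSubmodule := fun v => ⟨rep g v, W.apply_mem_toSubmodule g v.2⟩
  have hf : ∀ n v, ((f ^ n) v : Fin 6 → FieldFour) = rep (g ^ n) v := by
    intro n
    induction n with
    | zero => intro v; rw [pow_zero, pow_zero, map_one]; rfl
    | succ n ih =>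
      intro v
      rw [pow_succ, pow_succ, map_mul]
      exact ih (f v)
  have hf1 : f ^ 13 ^ 1 = 1 := by
    funext v
    refine Subtype.ext ((hf _ v).trans ?_)
    have hg : g ^ 13 ^ 1 = 1 := orderOf_dvd_iff_pow_eq_one.1 orderOf_thirteen.dvd
    rw [hg, map_one]
    rfl
  classical
  have hcard := Equiv.Perm.card_fixedPoints_modEq hf1
  have hfix : Fintype.card f.fixedPoints = 1 := by
    refine Fintype.card_eq_one_iff.2 ⟨⟨0, Subtype.ext (map_zero (rep g))⟩, ?_⟩
    rintro ⟨v, hv⟩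
    exact Subtype.ext (Subtype.ext (rep_sevenThirteenFree g (Or.inr orderOf_thirteen) v
      (congrArg Subtype.val hv)))
  rw [hfix, Module.card_eq_pow_finrank (K := FieldFour), ← Nat.card_eq_fintype_card,
    FieldFour.card] at hcard
  have hle := Submodule.finrank_le W.toSubmodule
  rw [Module.finrank_fin_fun] at hle
  have hcases : Module.finrank FieldFour W.toSubmodule = 0 ∨
      Module.finrank FieldFour W.toSubmodule = 6 := by
    generalize Module.finrank FieldFour W.toSubmodule = k at hcard hle
    interval_cases k <;> revert hcard <;> decide
  refine hcases.imp (fun h => ?_) fun h => ?_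
  · exact Subrepresentation.toSubmodule_injective (Submodule.finrank_eq_zero.1 h)
  · exact Subrepresentation.toSubmodule_injective
      (Submodule.eq_top_of_finrank_eq (h.trans (Module.finrank_fin_fun _).symm))

end PSL2Thirteen

/-! ## The split octonions -/

namespace Zorn

section Algebra

variable {k : Type*} [Field k]

local infixl:70 " ⋆ " => zornMul

/-- The unit of the split octonions. -/
def one (k : Type*) [Field k] : ZornMatrix k := (1, 0, 0, 1)

omit [Field k] in
theorem ext_coords {x y : ZornMatrix k} (h0 : x.1 = y.1) (h1 : ∀ i, x.2.1 i = y.2.1 i)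
    (h2 : ∀ i, x.2.2.1 i = y.2.2.1 i) (h3 : x.2.2.2 = y.2.2.2) : x = y :=
  Prod.ext h0 (Prod.ext (funext h1) (Prod.ext (funext h2) h3))

theorem mul_fst (x y : ZornMatrix k) : (x ⋆ y).1 =
    x.1 * y.1 + (x.2.1 0 * y.2.2.1 0 + x.2.1 1 * y.2.2.1 1 + x.2.1 2 * y.2.2.1 2) := by
  simp [zornMul, dotProduct, Fin.sum_univ_three]

/-- Indices are taken modulo `3`, which yields the cross product. -/
theorem mul_v (x y : ZornMatrix k) (i : Fin 3) : (x ⋆ y).2.1 i =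
    x.1 * y.2.1 i + y.2.2.2 * x.2.1 i -
      (x.2.2.1 (i + 1) * y.2.2.1 (i + 2) - x.2.2.1 (i + 2) * y.2.2.1 (i + 1)) := by
  fin_cases i <;> simp [zornMul, cross_apply, Matrix.vecHead, Matrix.vecTail]

theorem mul_w (x y : ZornMatrix k) (i : Fin 3) : (x ⋆ y).2.2.1 i =
    y.1 * x.2.2.1 i + x.2.2.2 * y.2.2.1 i +
      (x.2.1 (i + 1) * y.2.1 (i + 2) - x.2.1 (i + 2) * y.2.1 (i + 1)) := by
  fin_cases i <;> simp [zornMul, cross_apply, Matrix.vecHead, Matrix.vecTail]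

theorem mul_snd (x y : ZornMatrix k) : (x ⋆ y).2.2.2 =
    x.2.2.1 0 * y.2.1 0 + x.2.2.1 1 * y.2.1 1 + x.2.2.1 2 * y.2.1 2 + x.2.2.2 * y.2.2.2 := by
  simp [zornMul, dotProduct, Fin.sum_univ_three]

theorem add_mul (x y z : ZornMatrix k) : (x + y) ⋆ z = x ⋆ z + y ⋆ z := by
  refine ext_coords ?_ (fun i => ?_) (fun i => ?_) ?_ <;>
    simp only [mul_fst, mul_v, mul_w, mul_snd, Prod.fst_add, Prod.snd_add, Pi.add_apply] <;> ring

theorem mul_add (x y z : ZornMatrix k) : x ⋆ (y + z) = x ⋆ y + x ⋆ z := by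
  refine ext_coords ?_ (fun i => ?_) (fun i => ?_) ?_ <;>
    simp only [mul_fst, mul_v, mul_w, mul_snd, Prod.fst_add, Prod.snd_add, Pi.add_apply] <;> ring

theorem smul_mul (c : k) (x y : ZornMatrix k) : (c • x) ⋆ y = c • (x ⋆ y) := by
  refine ext_coords ?_ (fun i => ?_) (fun i => ?_) ?_ <;>
    simp only [mul_fst, mul_v, mul_w, mul_snd, Prod.smul_fst, Prod.smul_snd, Pi.smul_apply,
      smul_eq_mul] <;> ring

theorem mul_smul (c : k) (x y : ZornMatrix k) : x ⋆ (c • y) = c • (x ⋆ y) := by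
  refine ext_coords ?_ (fun i => ?_) (fun i => ?_) ?_ <;>
    simp only [mul_fst, mul_v, mul_w, mul_snd, Prod.smul_fst, Prod.smul_snd, Pi.smul_apply,
      smul_eq_mul] <;> ring

/-- The product of the split octonions as a bilinear map. -/
def mulLinear (k : Type*) [Field k] : ZornMatrix k →ₗ[k] ZornMatrix k →ₗ[k] ZornMatrix k :=
  LinearMap.mk₂ k zornMul add_mul smul_mul mul_add mul_smul

theorem mul_zero (x : ZornMatrix k) : x ⋆ 0 = 0 := map_zero (mulLinear k x)

theorem zero_mul (x : ZornMatrix k) : 0 ⋆ x = 0 := by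
  simpa using! smul_mul (0 : k) 0 x

theorem mul_sub (x y z : ZornMatrix k) : x ⋆ (y - z) = x ⋆ y - x ⋆ z := map_sub (mulLinear k x) y z

theorem one_mul (x : ZornMatrix k) : one k ⋆ x = x := by
  refine ext_coords ?_ (fun i => ?_) (fun i => ?_) ?_ <;>
    simp [mul_fst, mul_v, mul_w, mul_snd, one]

theorem mul_one (x : ZornMatrix k) : x ⋆ one k = x := by
  refine ext_coords ?_ (fun i => ?_) (fun i => ?_) ?_ <;>
    simp [mul_fst, mul_v, mul_w, mul_snd, one]

theorem left_alternative (x y : ZornMatrix k) : x ⋆ (x ⋆ y) = x ⋆ x ⋆ y := by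
  refine ext_coords ?_ (fun i => ?_) (fun i => ?_) ?_
  · simp only [mul_fst, mul_v, mul_w, Fin.reduceAdd]; ring
  · fin_cases i <;> simp [mul_fst, mul_v, mul_w, mul_snd] <;> ring
  · fin_cases i <;> simp [mul_fst, mul_v, mul_w, mul_snd] <;> ring
  · simp only [mul_v, mul_w, mul_snd, Fin.reduceAdd]; ring

theorem flexible (x y : ZornMatrix k) : x ⋆ y ⋆ x = x ⋆ (y ⋆ x) := by
  refine ext_coords ?_ (fun i => ?_) (fun i => ?_) ?_
  · simp only [mul_fst, mul_v, mul_w, Fin.reduceAdd]; ring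
  · fin_cases i <;> simp [mul_fst, mul_v, mul_w, mul_snd] <;> ring
  · fin_cases i <;> simp [mul_fst, mul_v, mul_w, mul_snd] <;> ring
  · simp only [mul_v, mul_w, mul_snd, Fin.reduceAdd]; ring

theorem left_alternative_linearized (x y z : ZornMatrix k) :
    x ⋆ (y ⋆ z) + y ⋆ (x ⋆ z) = (x ⋆ y + y ⋆ x) ⋆ z := by
  have h := left_alternative (x + y) z
  simp only [add_mul, mul_add, left_alternative] at h ⊢
  linear_combination (exp := 1) h

/-- The quadratic equation `x² = tr(x) x - N(x) 1`. -/
theorem mul_self (x : ZornMatrix k) : x ⋆ x = (x.1 + x.2.2.2) • x -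
    (x.1 * x.2.2.2 - (x.2.1 0 * x.2.2.1 0 + x.2.1 1 * x.2.2.1 1 + x.2.1 2 * x.2.2.1 2)) • one k := by
  refine ext_coords ?_ (fun i => ?_) (fun i => ?_) ?_ <;>
    simp [mul_fst, mul_v, mul_w, mul_snd, one] <;> ring

theorem trace_eq_zero_of_mul_self_eq_zero {x : ZornMatrix k} (h : x ⋆ x = 0) :
    x.1 + x.2.2.2 = 0 := by
  by_contra hne
  rw [mul_self, sub_eq_zero] at h
  have h1 : ∀ i, x.2.1 i = 0 := fun i => by
    have := congrArg (fun z => z.2.1 i) h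
    simpa [one, hne] using this
  have h0 := congrArg (fun z => z.1) h
  have h3 := congrArg (fun z => z.2.2.2) h
  simp [one, h1] at h0 h3
  have e0 : x.1 * x.1 = 0 := by linear_combination h0
  exact hne (by rw [mul_self_eq_zero.1 e0, h3, add_zero])

/-- Every nonzero element of square zero is part of a hyperbolic pair. -/
theorem exists_anticommutator_eq_one (h2 : (2 : k) ≠ 0) {x : ZornMatrix k} (hx : x ≠ 0)
    (h : x ⋆ x = 0) : ∃ z, x ⋆ z + z ⋆ x = one k := by
  have ht := trace_eq_zero_of_mul_self_eq_zero h
  have hb : x.2.2.2 = -x.1 := by linear_combination ht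
  -- The polar form of the norm is nondegenerate: `z` is dual to a nonzero coordinate of `x`. The
  -- diagonal case needs `2` invertible.
  by_cases ha : x.1 = 0
  · by_cases hv : ∀ i, x.2.1 i = 0
    · have hw : ∃ i, x.2.2.1 i ≠ 0 := by
        by_contra! hw
        exact hx (ext_coords ha hv hw (by simp [hb, ha]))
      obtain ⟨i, hi⟩ := hw
      refine ⟨(0, Pi.single i (x.2.2.1 i)⁻¹, 0, 0), ?_⟩
      refine ext_coords ?_ (fun j => ?_) (fun j => ?_) ?_ <;>
        simp [mul_fst, mul_v, mul_w, mul_snd, one, hb, ha, hv] <;> fin_cases i <;> simp_all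
    · push Not at hv
      obtain ⟨i, hi⟩ := hv
      refine ⟨(0, 0, Pi.single i (x.2.1 i)⁻¹, 0), ?_⟩
      refine ext_coords ?_ (fun j => ?_) (fun j => ?_) ?_ <;>
        simp [mul_fst, mul_v, mul_w, mul_snd, one, hb, ha] <;> fin_cases i <;> simp_all <;> ring
  · refine ⟨((2 * x.1)⁻¹, 0, 0, -(2 * x.1)⁻¹), ?_⟩
    refine ext_coords ?_ (fun j => ?_) (fun j => ?_) ?_ <;>
      simp [mul_fst, mul_v, mul_w, mul_snd, one, hb] <;> field_simp <;> norm_num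

end Algebra
end Zorn

namespace Zorn

local infixl:70 " ⋆ " => zornMul

/-! ### Hyperbolic pairs -/

section Hyperbolic

variable {k : Type*} [Field k]

/-- The right annihilator of `x`. -/
def annihilator (x : ZornMatrix k) : AddSubgroup (ZornMatrix k) :=
  (mulLinear k x).toAddMonoidHom.ker

theorem mem_annihilator {x z : ZornMatrix k} : z ∈ annihilator x ↔ x ⋆ z = 0 := Iff.rfl

variable {x y : ZornMatrix k} (hx : x ⋆ x = 0) (hxy : x ⋆ y + y ⋆ x = one k)

include hxy in
-- Left multiplications by `x` and `y` satisfy the Clifford relation, by linearized alternativity.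
theorem mul_mul_add_mul_mul (z : ZornMatrix k) : x ⋆ (y ⋆ z) + y ⋆ (x ⋆ z) = z := by
  rw [left_alternative_linearized, hxy, one_mul]

theorem mul_mem_annihilator {x : ZornMatrix k} (hx : x ⋆ x = 0) (z : ZornMatrix k) :
    x ⋆ z ∈ annihilator x := by
  rw [mem_annihilator, left_alternative, hx, zero_mul]

/-- A hyperbolic pair splits the octonions into two copies of the annihilator of one of its
members. -/
def equivAnnihilator (hx : x ⋆ x = 0) (hy : y ⋆ y = 0) (hxy : x ⋆ y + y ⋆ x = one k) :
    ZornMatrix k ≃ annihilator x × annihilator x where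
  toFun z := (⟨x ⋆ (y ⋆ z), mul_mem_annihilator hx _⟩, ⟨x ⋆ z, mul_mem_annihilator hx _⟩)
  invFun p := p.1.1 + y ⋆ p.2.1
  left_inv z := mul_mul_add_mul_mul hxy z
  right_inv := by
    rintro ⟨⟨a, ha⟩, ⟨b, hb⟩⟩
    rw [mem_annihilator] at ha hb
    have h1 := mul_mul_add_mul_mul hxy a
    have h2 := mul_mul_add_mul_mul hxy b
    rw [ha, mul_zero, add_zero] at h1
    rw [hb, mul_zero, add_zero] at h2
    refine Prod.ext (Subtype.ext ?_) (Subtype.ext ?_)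
    · change x ⋆ (y ⋆ (a + y ⋆ b)) = a
      rw [mul_add, left_alternative y b, hy, zero_mul, add_zero, h1]
    · change x ⋆ (a + y ⋆ b) = b
      rw [mul_add, ha, h2, zero_add]

include hx hxy in
theorem mul_mul_self_eq : x ⋆ y ⋆ x = x := by
  have h := mul_mul_add_mul_mul hxy x
  rwa [hx, mul_zero, add_zero, ← flexible] at h

include hx hxy in
-- Right multiplication by `x` kills `x` and sends `x ⋆ y` to `x`, so the two are independent.
theorem smul_add_smul_injective (hne : x ≠ 0) :
    Function.Injective fun c : k × k => c.1 • x + c.2 • (x ⋆ y) := by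
  intro c d h
  have h0 : (c.1 - d.1) • x + (c.2 - d.2) • (x ⋆ y) = 0 := by
    simp only [sub_smul]
    linear_combination (exp := 1) h
  have h1 := congrArg (· ⋆ x) h0
  simp only [add_mul, smul_mul, hx, mul_mul_self_eq hx hxy, smul_zero, zero_add, zero_mul] at h1
  have h2 : c.2 - d.2 = 0 := (smul_eq_zero.1 h1).resolve_right hne
  rw [h2, zero_smul, add_zero] at h0
  have h3 : c.1 - d.1 = 0 := (smul_eq_zero.1 h0).resolve_right hne
  exact Prod.ext (sub_eq_zero.1 h3) (sub_eq_zero.1 h2)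

end Hyperbolic

/-! ## Elements of prime power order of `G₂(3)` -/

section Action

variable {k : Type*} [Field k]

theorem smul_mul_eq (g : G₂ k) (x y : ZornMatrix k) : g • (x ⋆ y) = (g • x) ⋆ (g • y) := g.2 x y

theorem smul_smul_eq (g : G₂ k) (c : k) (x : ZornMatrix k) : g • (c • x) = c • (g • x) :=
  g.1.map_smul c x

/-- Preservation of the unit is not part of `G₂`; it follows because the image of the unit is again
a left unit. -/
theorem smul_one_eq (g : G₂ k) : g • one k = one k := by
  have h : g • (one k ⋆ (g⁻¹ • one k)) = one k := by rw [one_mul, smul_inv_smul]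
  rwa [smul_mul_eq, smul_inv_smul, mul_one] at h

theorem eq_one_of_forall_smul {g : G₂ k} (h : ∀ x : ZornMatrix k, g • x = x) : g = 1 :=
  Subtype.ext (LinearEquiv.ext h)

end Action

instance : Finite (ZornMatrix (ZMod 3) ≃ₗ[ZMod 3] ZornMatrix (ZMod 3)) :=
  Finite.of_injective _ DFunLike.coe_injective

/-- If `x` is a singular vector of trace zero, then `t` can be corrected by a multiple of `x` so that
the two form a hyperbolic pair. -/
theorem exists_sub_smul_mul_self {k : Type*} [Field k] {x t : ZornMatrix k} (hne : x ≠ 0)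
    (hx : x ⋆ x = 0) (hxt : x ⋆ t + t ⋆ x = one k) :
    ∃ c : k, (t - c • x) ⋆ (t - c • x) = 0 := by
  -- The polarized quadratic equation. With `tr(x) = 0` it makes `tr(t) x` a multiple of the unit;
  -- multiplying by `x` shows that multiple to be zero. So `tr(t) = 0` and `t² = n 1`, whence `(t -
  -- n x)² = n 1 - n (x t + t x) = 0`.
  have hanti : x ⋆ t + t ⋆ x = (x.1 + x.2.2.2) • t + (t.1 + t.2.2.2) • x -
      (x.1 * t.2.2.2 + t.1 * x.2.2.2 -
        (x.2.1 0 * t.2.2.1 0 + x.2.1 1 * t.2.2.1 1 + x.2.1 2 * t.2.2.1 2) -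
        (t.2.1 0 * x.2.2.1 0 + t.2.1 1 * x.2.2.1 1 + t.2.1 2 * x.2.2.1 2)) • one k := by
    refine ext_coords ?_ (fun i => ?_) (fun i => ?_) ?_ <;>
      simp [mul_fst, mul_v, mul_w, mul_snd, one] <;> ring
  rw [trace_eq_zero_of_mul_self_eq_zero hx, zero_smul, zero_add, hxt] at hanti
  generalize (x.1 * t.2.2.2 + t.1 * x.2.2.2 - _ - _ : k) = b at hanti
  have h1 : (t.1 + t.2.2.2) • x = (1 + b) • one k := by
    rw [add_smul 1 b, one_smul]
    exact (eq_sub_iff_add_eq.1 hanti).symm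
  have h2 := congrArg (x ⋆ ·) h1
  simp only [mul_smul, hx, smul_zero, mul_one] at h2
  rw [(smul_eq_zero.1 h2.symm).resolve_right hne, zero_smul] at h1
  have ht := mul_self t
  rw [(smul_eq_zero.1 h1).resolve_right hne, zero_smul, zero_sub, ← neg_smul] at ht
  generalize -(t.1 * t.2.2.2 - _ : k) = n at ht
  refine ⟨n, ?_⟩
  rw [sub_eq_add_neg t, ← neg_smul, mul_add, add_mul, add_mul, mul_smul, smul_mul, smul_mul,
    mul_smul, hx, smul_zero, smul_zero, add_zero, add_assoc, ← smul_add, hxt, ht, ← add_smul,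
    add_neg_cancel, zero_smul]

/-- An element of order prime to `3` that fixes a singular vector fixes a hyperbolic pair. -/
theorem exists_fixed_hyperbolic {g : G₂ (ZMod 3)} {n : ℕ} (hn : ((n : ZMod 3)) ≠ 0) (hg : g ^ n = 1)
    {x : ZornMatrix (ZMod 3)} (hne : x ≠ 0) (hx : x ⋆ x = 0) (hgx : g • x = x) :
    ∃ y, g • y = y ∧ y ⋆ y = 0 ∧ x ⋆ y + y ⋆ x = one (ZMod 3) := by
  obtain ⟨z, hz⟩ := exists_anticommutator_eq_one (by decide) hne hx
  have hpow : ∀ i : ℕ, g ^ i • x = x := fun i => by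
    induction i with
    | zero => rw [pow_zero, one_smul]
    | succ i ih => rw [pow_succ, SemigroupAction.mul_smul, hgx, ih]
  have hpow' : ∀ i : ℕ, x ⋆ (g ^ i • z) + (g ^ i • z) ⋆ x = one (ZMod 3) := fun i => by
    have h := congrArg (g ^ i • ·) hz
    simp only [smul_add, smul_mul_eq, hpow, smul_one_eq] at h
    exact h
  -- Averaging `z` over the powers of `g`; the division by `n` is possible in characteristic `3`.
  obtain ⟨s, hs⟩ : ∃ s, s = ∑ i ∈ Finset.range n, g ^ i • z := ⟨_, rfl⟩
  have hgs : g • s = s := by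
    have h1 : g • s = ∑ i ∈ Finset.range n, g ^ (i + 1) • z := by
      rw [hs, Finset.smul_sum]
      exact Finset.sum_congr rfl fun i _ => by rw [pow_succ', SemigroupAction.mul_smul]
    have h2 := Finset.sum_range_succ' (fun i => g ^ i • z) n
    rw [Finset.sum_range_succ, hg, pow_zero, add_left_inj] at h2
    rw [h1, ← h2, hs]
  have hxs : x ⋆ s + s ⋆ x = (n : ZMod 3) • one (ZMod 3) := by
    have h1 : x ⋆ s = ∑ i ∈ Finset.range n, x ⋆ (g ^ i • z) := by
      rw [hs]; exact map_sum (mulLinear (ZMod 3) x) _ _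
    have h2 : s ⋆ x = ∑ i ∈ Finset.range n, (g ^ i • z) ⋆ x := by
      rw [hs]; exact map_sum ((mulLinear (ZMod 3)).flip x) _ _
    rw [h1, h2, ← Finset.sum_add_distrib, Finset.sum_congr rfl fun i _ => hpow' i, Finset.sum_const,
      Finset.card_range, Nat.cast_smul_eq_nsmul]
  obtain ⟨t, ht⟩ : ∃ t, t = (n : ZMod 3)⁻¹ • s := ⟨_, rfl⟩
  have hgt : g • t = t := by rw [ht, smul_smul_eq, hgs]
  have hxt : x ⋆ t + t ⋆ x = one (ZMod 3) := by
    rw [ht, mul_smul, smul_mul, ← smul_add, hxs, smul_smul, inv_mul_cancel₀ hn, one_smul]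
  obtain ⟨c, hc⟩ := exists_sub_smul_mul_self hne hx hxt
  refine ⟨t - c • x, ?_, hc, ?_⟩
  · rw [smul_sub, smul_smul_eq, hgt, hgx]
  · rw [mul_sub, mul_smul, hx, smul_zero, sub_zero, sub_eq_add_neg, ← neg_smul, add_mul, smul_mul, hx,
      smul_zero, add_zero, hxt]

theorem card_annihilator {x y : ZornMatrix (ZMod 3)} (hx : x ⋆ x = 0) (hy : y ⋆ y = 0)
    (hxy : x ⋆ y + y ⋆ x = one (ZMod 3)) : Nat.card (annihilator x) = 3 ^ 4 := by
  have h := Nat.card_congr (equivAnnihilator hx hy hxy)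
  rw [Nat.card_prod, Nat.card_prod, Nat.card_prod, Nat.card_prod, Nat.card_fun, Nat.card_zmod,
    Nat.card_fin] at h
  exact Nat.mul_self_inj.1 (h.symm.trans (by norm_num))

/-- The fixed points of `g` in the annihilator of `x`. -/
def fixedAnnihilator (g : G₂ (ZMod 3)) (x : ZornMatrix (ZMod 3)) :
    AddSubgroup (ZornMatrix (ZMod 3)) where
  carrier := {z | z ∈ annihilator x ∧ g • z = z}
  zero_mem' := ⟨zero_mem _, smul_zero g⟩
  add_mem' := fun ha hb => ⟨add_mem ha.1 hb.1, by rw [smul_add, ha.2, hb.2]⟩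
  neg_mem' := fun ha => ⟨neg_mem ha.1, by rw [smul_neg, ha.2]⟩

open Function in
theorem card_modEq_card_fixed {G α : Type*} [Group G] [MulAction G α] {g : G} {p m : ℕ}
    [Fact p.Prime] (hg : g ^ p ^ m = 1) (A : Set α) [Finite A] (hA : ∀ z ∈ A, g • z ∈ A) :
    Nat.card A ≡ Nat.card {z | z ∈ A ∧ g • z = z} [MOD p] := by
  classical
  have := Fintype.ofFinite A
  obtain ⟨f, hf⟩ : ∃ f : Function.End A, ∀ z : A, (f z : α) = g • z.1 :=
    ⟨fun z => ⟨g • z.1, hA z z.2⟩, fun z => rfl⟩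
  have hfn : ∀ n v, ((f ^ n) v : α) = g ^ n • v.1 := by
    intro n
    induction n with
    | zero => intro v; rw [pow_zero, pow_zero, one_smul]; rfl
    | succ n ih =>
      intro v
      rw [pow_succ, pow_succ, SemigroupAction.mul_smul, ← hf]
      exact ih (f v)
  have hf1 : f ^ p ^ m = 1 := by
    funext v
    refine Subtype.ext ((hfn _ v).trans ?_)
    rw [hg, one_smul]
    rfl
  have hmod := Equiv.Perm.card_fixedPoints_modEq hf1
  rw [Fintype.card_eq_nat_card, Fintype.card_eq_nat_card] at hmod
  refine hmod.trans (congrArg (· % p) (Nat.card_congr ?_))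
  exact
    { toFun := fun z => ⟨z.1.1, z.1.2, (hf z.1).symm.trans (congrArg Subtype.val z.2)⟩
      invFun := fun z => ⟨⟨z.1, z.2.1⟩, Subtype.ext ((hf _).trans z.2.2)⟩
      left_inv := fun z => rfl
      right_inv := fun z => rfl }

/-- The fixed points form a subgroup of order `3 ^ j`, with `j ≥ 2` because it contains `x` and `x ⋆
y`. Modulo `p` its order agrees with `3 ^ 4`, and `3 ^ 4 - 3 ^ 2 = 2 ^ 3 * 3 ^ 2` and `3 ^ 4 - 3 ^ 3
= 2 * 3 ^ 3` have no prime factor `p ≥ 5`. -/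
theorem smul_eq_of_mem_annihilator {p m : ℕ} (hp : p.Prime) (hp5 : 5 ≤ p) {g : G₂ (ZMod 3)}
    (hg : g ^ p ^ m = 1) {x y : ZornMatrix (ZMod 3)} (hne : x ≠ 0) (hx : x ⋆ x = 0) (hgx : g • x = x)
    (hy : y ⋆ y = 0) (hgy : g • y = y) (hxy : x ⋆ y + y ⋆ x = one (ZMod 3)) :
    ∀ z ∈ annihilator x, g • z = z := by
  have := Fact.mk hp
  have hstab : ∀ z ∈ annihilator x, g • z ∈ annihilator x := fun z hz => by
    have h := congrArg (g • ·) (mem_annihilator.1 hz)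
    simp only [smul_mul_eq, hgx, smul_zero] at h
    exact h
  have hmod := card_modEq_card_fixed hg (annihilator x : Set (ZornMatrix (ZMod 3))) hstab
  have hcard : Nat.card {z | z ∈ (annihilator x : Set (ZornMatrix (ZMod 3))) ∧ g • z = z} =
      Nat.card (fixedAnnihilator g x) := rfl
  have hle : fixedAnnihilator g x ≤ annihilator x := fun z hz => hz.1
  rw [hcard, SetLike.coe_sort_coe, card_annihilator hx hy hxy] at hmod
  have hdvd := AddSubgroup.card_dvd_of_le hle
  rw [card_annihilator hx hy hxy] at hdvd
  obtain ⟨j, hj, hj'⟩ := (Nat.dvd_prime_pow Nat.prime_three).1 hdvd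
  have h9 : 3 ^ 2 ≤ Nat.card (fixedAnnihilator g x) := by
    have hinj := smul_add_smul_injective hx hxy hne
    have h : ∀ c : ZMod 3 × ZMod 3, c.1 • x + c.2 • (x ⋆ y) ∈ fixedAnnihilator g x := fun c => by
      constructor
      · rw [mem_annihilator, mul_add, mul_smul, mul_smul, hx, left_alternative, hx, zero_mul,
          smul_zero, smul_zero, add_zero]
      · rw [smul_add, smul_smul_eq, smul_smul_eq, smul_mul_eq, hgx, hgy]
    have h' := Nat.card_le_card_of_injective
      (fun c : ZMod 3 × ZMod 3 => (⟨_, h c⟩ : fixedAnnihilator g x))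
      fun c d hcd => hinj (congrArg Subtype.val hcd)
    rwa [Nat.card_prod, Nat.card_zmod, ← pow_two] at h'
  rw [hj'] at hmod
  rw [hj'] at h9
  have hj2 := (Nat.pow_le_pow_iff_right (by norm_num)).1 h9
  have hj4 : j = 4 := by
    have hnd : ∀ q r : ℕ, p ∣ 2 ^ q * 3 ^ r → False := fun q r hd => by
      rcases hp.dvd_mul.1 hd with h | h
      · have := (Nat.prime_dvd_prime_iff_eq hp Nat.prime_two).1 (hp.dvd_of_dvd_pow h); omega
      · have := (Nat.prime_dvd_prime_iff_eq hp Nat.prime_three).1 (hp.dvd_of_dvd_pow h); omega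
    have hd := (Nat.modEq_iff_dvd' (Nat.pow_le_pow_right (by norm_num) hj)).1 hmod.symm
    interval_cases j
    · exact (hnd 3 2 hd).elim
    · exact (hnd 1 3 hd).elim
    · rfl
  rw [hj4, ← card_annihilator hx hy hxy] at hj'
  intro z hz
  have heq := AddSubgroup.eq_of_le_of_card_ge hle hj'.ge
  exact (heq.ge hz).2

/-- `g` fixes `y` and the annihilator of `x` pointwise, and these generate: `z = x ⋆ (y ⋆ z) + y ⋆
(x ⋆ z)`. -/
theorem eq_one_of_smul_singular {p m : ℕ} (hp : p.Prime) (hp5 : 5 ≤ p) {g : G₂ (ZMod 3)}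
    (hg : g ^ p ^ m = 1) {x : ZornMatrix (ZMod 3)} (hne : x ≠ 0) (hx : x ⋆ x = 0)
    (hgx : g • x = x) : g = 1 := by
  have hn : ((p ^ m : ℕ) : ZMod 3) ≠ 0 := by
    rw [Ne, ZMod.natCast_eq_zero_iff]
    intro h
    have := (Nat.prime_dvd_prime_iff_eq Nat.prime_three hp).1 (Nat.prime_three.dvd_of_dvd_pow h)
    omega
  obtain ⟨y, hgy, hy, hxy⟩ := exists_fixed_hyperbolic hn hg hne hx hgx
  have h := smul_eq_of_mem_annihilator hp hp5 hg hne hx hgx hy hgy hxy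
  refine eq_one_of_forall_smul fun z => ?_
  rw [← mul_mul_add_mul_mul hxy z, smul_add, smul_mul_eq g y, h _ (mul_mem_annihilator hx _),
    h _ (mul_mem_annihilator hx _), hgy]

/-! ### Singular vectors and the primes dividing the order of `G₂(3)` -/

/-- The nonzero singular vectors of trace zero. -/
def singular : SubMulAction (G₂ (ZMod 3)) (ZornMatrix (ZMod 3)) where
  carrier := {x | x ≠ 0 ∧ x ⋆ x = 0}
  smul_mem' g x hx := ⟨fun h => hx.1 ((smul_eq_zero_iff_eq g).1 h), by
    rw [← smul_mul_eq, hx.2, smul_zero]⟩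

theorem mul_self_eq_zero_iff {k : Type*} [Field k] (x : ZornMatrix k) :
    x ⋆ x = 0 ↔ x.1 + x.2.2.2 = 0 ∧
      x.1 * x.1 + (x.2.1 0 * x.2.2.1 0 + x.2.1 1 * x.2.2.1 1 + x.2.1 2 * x.2.2.1 2) = 0 := by
  constructor
  · intro h
    exact ⟨trace_eq_zero_of_mul_self_eq_zero h, by rw [← mul_fst, h]; rfl⟩
  · rintro ⟨h1, h2⟩
    rw [mul_self, h1, zero_smul, zero_sub, neg_eq_zero,
      show x.1 * x.2.2.2 - _ = (0 : k) by linear_combination x.1 * h1 - h2, zero_smul]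

theorem card_singular : Nat.card singular = 728 := by
  have h : Nat.card {x : ZornMatrix (ZMod 3) // x.1 + x.2.2.2 = 0 ∧ x.1 * x.1 + (x.2.1 0 * x.2.2.1 0 +
      x.2.1 1 * x.2.2.1 1 + x.2.1 2 * x.2.2.1 2) = 0 ∧ x ≠ 0} = 728 := by
    rw [Nat.card_eq_fintype_card, Fintype.card_subtype]
    decide +kernel
  rw [← h]
  refine Nat.card_congr (Equiv.subtypeEquivRight fun x => ?_)
  change x ≠ 0 ∧ x ⋆ x = 0 ↔ _
  rw [mul_self_eq_zero_iff]
  tauto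

theorem card_sylow_dvd {p : ℕ} [hp : Fact p.Prime] (hp5 : 5 ≤ p) (P : Sylow p (G₂ (ZMod 3))) :
    Nat.card P ∣ 728 := by
  have h : ∀ x : singular, MulAction.stabilizer P x = ⊥ := fun x => by
    refine (Subgroup.eq_bot_iff_forall _).2 fun g hg => Subtype.ext ?_
    obtain ⟨m, hm⟩ := P.2 g
    refine eq_one_of_smul_singular hp.out hp5 (m := m) (congrArg Subtype.val hm) x.2.1 x.2.2 ?_
    exact congrArg Subtype.val (MulAction.mem_stabilizer_iff.1 hg)
  have h' := Nat.card_congr (MulAction.selfEquivOrbitsQuotientProd h)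
  rw [Nat.card_prod, card_singular] at h'
  exact Dvd.intro_left _ h'.symm

theorem pow_dvd_of_pow_dvd_card {p : ℕ} (hp : p.Prime) (hp5 : 5 ≤ p) {n : ℕ}
    (h : p ^ n ∣ Nat.card (G₂ (ZMod 3))) : p ^ n ∣ 728 := by
  have := Fact.mk hp
  obtain ⟨P⟩ : Nonempty (Sylow p (G₂ (ZMod 3))) := inferInstance
  exact (P.pow_dvd_card_of_pow_dvd_card h).trans (card_sylow_dvd hp5 P)

theorem not_sq_dvd_card {p : ℕ} (hp : p.Prime) (hp5 : 5 ≤ p) :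
    ¬ p ^ 2 ∣ Nat.card (G₂ (ZMod 3)) := by
  intro h
  have h1 := pow_dvd_of_pow_dvd_card hp hp5 h
  -- `27 ^ 2 = 729` exceeds `728`.
  have h2 : p ≤ 26 := by
    by_contra! h3
    have := Nat.pow_le_pow_left (show 27 ≤ p from h3) 2
    have := Nat.le_of_dvd (by norm_num) h1
    omega
  interval_cases p <;> revert h1 <;> decide

theorem prime_dvd_card {p : ℕ} (hp : p.Prime) (h : p ∣ Nat.card (G₂ (ZMod 3))) :
    p = 2 ∨ p = 3 ∨ p = 7 ∨ p = 13 := by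
  by_cases hp5 : 5 ≤ p
  · have h1 := pow_dvd_of_pow_dvd_card hp hp5 (n := 1) (by rwa [pow_one])
    rw [pow_one, show 728 = 2 ^ 3 * 7 * 13 by norm_num, hp.dvd_mul, hp.dvd_mul] at h1
    have key : ∀ q : ℕ, q.Prime → p ∣ q → p = q := fun q hq => (Nat.prime_dvd_prime_iff_eq hp hq).1
    rcases h1 with (h1 | h1) | h1
    · exact Or.inl (key 2 (by norm_num) (hp.dvd_of_dvd_pow h1))
    · exact Or.inr (Or.inr (Or.inl (key 7 (by norm_num) h1)))
    · exact Or.inr (Or.inr (Or.inr (key 13 (by norm_num) h1)))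
  · have := hp.two_le
    interval_cases p
    · simp
    · simp
    · exact absurd hp (by norm_num)

end Zorn

namespace Zorn

local infixl:70 " ⋆ " => zornMul

/-! ## Explicit automorphisms -/

section Basis

variable {k : Type*} [Field k]

/-- The standard basis of the split octonions. -/
def stdBasis (k : Type*) [Field k] : Fin 8 → ZornMatrix k :=
  ![(1, 0, 0, 0), (0, ![1, 0, 0], 0, 0), (0, ![0, 1, 0], 0, 0), (0, ![0, 0, 1], 0, 0),
    (0, 0, ![1, 0, 0], 0), (0, 0, ![0, 1, 0], 0), (0, 0, ![0, 0, 1], 0), (0, 0, 0, 1)]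

theorem eq_sum_stdBasis (x : ZornMatrix k) :
    x = x.1 • stdBasis k 0 + x.2.1 0 • stdBasis k 1 + x.2.1 1 • stdBasis k 2 +
      x.2.1 2 • stdBasis k 3 + x.2.2.1 0 • stdBasis k 4 + x.2.2.1 1 • stdBasis k 5 +
      x.2.2.1 2 • stdBasis k 6 + x.2.2.2 • stdBasis k 7 := by
  refine ext_coords ?_ (fun i => ?_) (fun i => ?_) ?_
  · simp [stdBasis]
  · fin_cases i <;> simp [stdBasis]
  · fin_cases i <;> simp [stdBasis]
  · simp [stdBasis]

theorem eq_top_of_stdBasis_mem (W : Submodule k (ZornMatrix k)) (h : ∀ i, stdBasis k i ∈ W)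
    (x : ZornMatrix k) : x ∈ W := by
  rw [eq_sum_stdBasis x]
  exact W.add_mem (W.add_mem (W.add_mem (W.add_mem (W.add_mem (W.add_mem (W.add_mem
    (W.smul_mem _ (h 0)) (W.smul_mem _ (h 1))) (W.smul_mem _ (h 2))) (W.smul_mem _ (h 3)))
    (W.smul_mem _ (h 4))) (W.smul_mem _ (h 5))) (W.smul_mem _ (h 6))) (W.smul_mem _ (h 7))

theorem linearMap_ext {M : Type*} [AddCommGroup M] [Module k M] {f g : ZornMatrix k →ₗ[k] M}
    (h : ∀ i, f (stdBasis k i) = g (stdBasis k i)) : f = g :=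
  LinearMap.ext fun x => eq_top_of_stdBasis_mem (LinearMap.eqLocus f g) h x

/-- An endomorphism of finite order of the split octonions, as an element of `G₂`. -/
def autOfPow (f : ZornMatrix k →ₗ[k] ZornMatrix k) (n : ℕ)
    (hf : ∀ i, (f^[n] (f (stdBasis k i))) = stdBasis k i)
    (hmul : ∀ i j, f (stdBasis k i ⋆ stdBasis k j) = f (stdBasis k i) ⋆ f (stdBasis k j)) : G₂ k :=
  -- `n` is one less than the exponent: the inverse of `f` is `f ^ n`.
  have h : f ^ n * f = 1 := linearMap_ext fun i => by
    rw [Module.End.mul_apply, Module.End.pow_apply]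
    exact hf i
  ⟨LinearEquiv.ofLinearMap f (f ^ n) ((pow_succ' f n).symm.trans ((pow_succ f n).trans h)) h, fun x y => by
    have h1 : (mulLinear k).compr₂ f = (mulLinear k).compl₁₂ f f :=
      linearMap_ext fun i => linearMap_ext fun j => hmul i j
    exact congrArg (fun B => B x y) h1⟩

theorem pow_smul_autOfPow (f : ZornMatrix k →ₗ[k] ZornMatrix k) (n : ℕ) (hf) (hmul) (m : ℕ)
    (x : ZornMatrix k) : autOfPow f n hf hmul ^ m • x = f^[m] x := by
  exact (congrFun (smul_iterate (autOfPow f n hf hmul) m) x).symm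

/-- The vectors fixed by an automorphism. -/
def fixedSubmodule (g : G₂ k) : Submodule k (ZornMatrix k) :=
  LinearMap.eqLocus g.1.toLinearMap LinearMap.id

theorem mem_fixedSubmodule {g : G₂ k} {x : ZornMatrix k} : x ∈ fixedSubmodule g ↔ g • x = x :=
  Iff.rfl

theorem mul_mem_fixedSubmodule {g : G₂ k} {x y : ZornMatrix k} (hx : x ∈ fixedSubmodule g)
    (hy : y ∈ fixedSubmodule g) : x ⋆ y ∈ fixedSubmodule g := by
  rw [mem_fixedSubmodule] at hx hy ⊢
  rw [smul_mul_eq, hx, hy]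

theorem one_mem_fixedSubmodule (g : G₂ k) : one k ∈ fixedSubmodule g := smul_one_eq g

theorem autOfPow_pow (f : ZornMatrix k →ₗ[k] ZornMatrix k) (n : ℕ) (hf) (hmul) :
    autOfPow f n hf hmul ^ (n + 1) = 1 := by
  refine eq_one_of_forall_smul (eq_top_of_stdBasis_mem (fixedSubmodule _) fun i => ?_)
  rw [mem_fixedSubmodule, pow_smul_autOfPow]
  exact hf i

/-- If `v` and its translates under `g` generate the octonions, an automorphism that commutes with
`g` and moves `v` along its `g`-orbit is a power of `g`. -/
theorem mem_zpowers_of_commute {g c : G₂ k} (hc : Commute c g) {v : ZornMatrix k} {i : ℕ}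
    (hv : c • v = g ^ i • v)
    (hgen : ∀ f : G₂ k, (∀ j : ℕ, g ^ j • v ∈ fixedSubmodule f) →
      ∀ l, stdBasis k l ∈ fixedSubmodule f) : c ∈ Subgroup.zpowers g := by
  -- This element fixes `v` and commutes with `g`, so it fixes all translates of `v`.
  have hf : (g ^ i)⁻¹ * c = 1 := by
    have hcomm : Commute ((g ^ i)⁻¹ * c) g :=
      (((Commute.refl g).pow_left i).inv_left).mul_left hc
    refine eq_one_of_forall_smul (eq_top_of_stdBasis_mem (fixedSubmodule _) (hgen _ fun j => ?_))
    rw [mem_fixedSubmodule, ← SemigroupAction.mul_smul, (hcomm.pow_right j).eq,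
      SemigroupAction.mul_smul, SemigroupAction.mul_smul, hv, inv_smul_smul]
  rw [inv_mul_eq_one] at hf
  exact hf ▸ Subgroup.npow_mem_zpowers g i

end Basis

/-! ### Automorphisms of orders `7`, `13` and `6` -/

/-- An automorphism of order `7`. -/
def sevenLinear : ZornMatrix (ZMod 3) →ₗ[ZMod 3] ZornMatrix (ZMod 3) where
  toFun x := (x.1 - x.2.2.1 2,
    ![x.1 - x.2.1 0 + x.2.1 2 - x.2.2.1 2 - x.2.2.2, -x.2.1 0, -x.2.1 1],
    ![x.2.2.1 2, x.2.1 1 - x.2.2.1 0 - x.2.2.1 2, -x.2.1 0 - x.2.2.1 1],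
    x.2.2.1 2 + x.2.2.2)
  map_add' x y := by
    refine ext_coords ?_ (fun i => ?_) (fun i => ?_) ?_
    · simp; ring
    · fin_cases i <;> simp <;> ring
    · fin_cases i <;> simp <;> ring
    · simp; ring
  map_smul' c x := by
    refine ext_coords ?_ (fun i => ?_) (fun i => ?_) ?_
    · simp; ring
    · fin_cases i <;> simp <;> ring
    · fin_cases i <;> simp <;> ring
    · simp; ring

/-- An automorphism of order `13`, the action of a Singer cycle of `SL₃(3)`. -/
def thirteenLinear : ZornMatrix (ZMod 3) →ₗ[ZMod 3] ZornMatrix (ZMod 3) where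
  toFun x := (x.1, ![x.2.1 1 - x.2.1 0, x.2.1 2, x.2.1 0],
    ![x.2.2.1 1, x.2.2.1 2, x.2.2.1 0 + x.2.2.1 1], x.2.2.2)
  map_add' x y := by
    refine ext_coords ?_ (fun i => ?_) (fun i => ?_) ?_
    · simp
    · fin_cases i <;> simp <;> ring
    · fin_cases i <;> simp <;> ring
    · simp
  map_smul' c x := by
    refine ext_coords ?_ (fun i => ?_) (fun i => ?_) ?_
    · simp
    · fin_cases i <;> simp <;> ring
    · fin_cases i <;> simp <;> ring
    · simp

/-- An automorphism of order `6`. -/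
def sixLinear : ZornMatrix (ZMod 3) →ₗ[ZMod 3] ZornMatrix (ZMod 3) where
  toFun x := (x.1, ![x.2.1 1 - x.2.1 0, x.2.1 2, x.2.1 1],
    ![-x.2.2.1 0, x.2.2.1 2, x.2.2.1 0 + x.2.2.1 1], x.2.2.2)
  map_add' x y := by
    refine ext_coords ?_ (fun i => ?_) (fun i => ?_) ?_
    · simp
    · fin_cases i <;> simp <;> ring
    · fin_cases i <;> simp <;> ring
    · simp
  map_smul' c x := by
    refine ext_coords ?_ (fun i => ?_) (fun i => ?_) ?_
    · simp
    · fin_cases i <;> simp <;> ring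
    · fin_cases i <;> simp <;> ring
    · simp

/-- An automorphism of order `7`. -/
def seven : G₂ (ZMod 3) := autOfPow sevenLinear 6 (by decide +kernel) (by decide +kernel)

/-- An automorphism of order `13`. -/
def thirteen : G₂ (ZMod 3) := autOfPow thirteenLinear 12 (by decide +kernel) (by decide +kernel)

/-- An automorphism of order `6`. -/
def six : G₂ (ZMod 3) := autOfPow sixLinear 5 (by decide +kernel) (by decide +kernel)

theorem orderOf_seven : orderOf seven = 7 := by
  have := Fact.mk (show Nat.Prime 7 by norm_num)
  refine orderOf_eq_prime (autOfPow_pow _ _ _ _) fun h => ?_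
  have h1 : sevenLinear (stdBasis _ 0) = stdBasis _ 0 := congrArg (· • stdBasis (ZMod 3) 0) h
  exact absurd h1 (by decide +kernel)

theorem orderOf_thirteen : orderOf thirteen = 13 := by
  have := Fact.mk (show Nat.Prime 13 by norm_num)
  refine orderOf_eq_prime (autOfPow_pow _ _ _ _) fun h => ?_
  have h1 : thirteenLinear (stdBasis _ 1) = stdBasis _ 1 := congrArg (· • stdBasis (ZMod 3) 1) h
  exact absurd h1 (by decide +kernel)

theorem orderOf_six : orderOf six = 6 := by
  refine orderOf_eq_of_pow_and_pow_div_prime (by norm_num) (autOfPow_pow _ _ _ _)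
    fun p hp hd h => ?_
  have h' : ∀ i, sixLinear^[6 / p] (stdBasis _ i) = stdBasis _ i := fun i => by
    rw [← pow_smul_autOfPow sixLinear 5 (by decide +kernel) (by decide +kernel)]
    exact congrArg (· • stdBasis (ZMod 3) i) h
  rcases (Nat.Prime.dvd_mul hp).1 (show p ∣ 2 * 3 from hd) with h2 | h2
  · rw [(Nat.prime_dvd_prime_iff_eq hp (by norm_num)).1 h2] at h'
    exact absurd (h' 1) (by decide +kernel)
  · rw [(Nat.prime_dvd_prime_iff_eq hp (by norm_num)).1 h2] at h'
    exact absurd (h' 2) (by decide +kernel)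

/-! ### Centralizers -/

/-- An imaginary unit, whose translates under `seven` multiply like the usual basis of the
octonions. -/
def imaginaryUnit : ZornMatrix (ZMod 3) := (0, ![0, 1, 1], ![0, 0, 2], 0)

/-- With nonzero trace the off-diagonal term `d` would vanish, making `-1` a square modulo `3`. -/
theorem fst_add_snd_eq_zero_of_mul_self {x : ZornMatrix (ZMod 3)} (h : x ⋆ x = -one (ZMod 3)) :
    x.1 + x.2.2.2 = 0 := by
  have key : ∀ a b d : ZMod 3, a * a + d = -1 → b * b + d = -1 → (a + b) * (d * d) = 0 → a + b = 0 := by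
    decide
  have h1 : ∀ i, (x.1 + x.2.2.2) * x.2.1 i = 0 := fun i => by
    have := congrArg (fun z => z.2.1 i) h
    rw [mul_self] at this
    simpa [one] using this
  have h0 := mul_fst x x
  have h3 := mul_snd x x
  rw [h] at h0 h3
  refine key _ _ (x.2.1 0 * x.2.2.1 0 + x.2.1 1 * x.2.2.1 1 + x.2.1 2 * x.2.2.1 2) h0.symm
    ((h3.trans (by ring)).symm) ?_
  generalize hd : x.2.1 0 * x.2.2.1 0 + x.2.1 1 * x.2.2.1 1 + x.2.1 2 * x.2.2.1 2 = d
  rw [← mul_assoc]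
  have : (x.1 + x.2.2.2) * d = 0 := by
    rw [← hd]
    linear_combination x.2.2.1 0 * h1 0 + x.2.2.1 1 * h1 1 + x.2.2.1 2 * h1 2
  rw [this, MulZeroClass.zero_mul]

set_option synthInstance.maxSize 1000 in
-- An exhaustive check over `3 ^ 7` trace-zero vectors. The relation is the octonion rule `e_i
-- e_{i+1} = e_{i+3}` with indices modulo `7`.
theorem eq_iterate_sevenLinear_coords (a : ZMod 3) : ∀ v w : Fin 3 → ZMod 3,
    a * a + (v 0 * w 0 + v 1 * w 1 + v 2 * w 2) = -1 →
    let x : ZornMatrix (ZMod 3) := (a, v, w, -a)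
    x ⋆ sevenLinear x = sevenLinear (sevenLinear (sevenLinear x)) →
      ∃ i : Fin 7, x = sevenLinear^[i] imaginaryUnit := by
  revert a
  decide +kernel

theorem eq_iterate_sevenLinear {x : ZornMatrix (ZMod 3)} (hx : x ⋆ x = -one (ZMod 3))
    (h : x ⋆ sevenLinear x = sevenLinear (sevenLinear (sevenLinear x))) :
    ∃ i : Fin 7, x = sevenLinear^[i] imaginaryUnit := by
  have hb : x = (x.1, x.2.1, x.2.2.1, -x.1) := by
    rw [← eq_neg_of_add_eq_zero_right (fst_add_snd_eq_zero_of_mul_self hx)]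
  have h0 := mul_fst x x
  rw [hx] at h0
  rw [hb] at h ⊢
  exact eq_iterate_sevenLinear_coords x.1 x.2.1 x.2.2.1 h0.symm h

/-- The coordinates of the standard basis in the basis that consists of the translates of
`imaginaryUnit` and of the unit. -/
def changeOfBasis : Fin 8 → Fin 8 → ZMod 3 :=
  ![![0, 1, 1, 2, 2, 2, 0, 2], ![0, 2, 0, 2, 0, 0, 2, 0], ![0, 2, 1, 2, 2, 2, 2, 0],
    ![2, 0, 2, 0, 0, 2, 0, 0], ![0, 2, 2, 1, 2, 1, 2, 0], ![1, 0, 1, 1, 2, 1, 2, 0],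
    ![1, 2, 0, 2, 2, 1, 2, 0], ![0, 2, 2, 1, 1, 1, 0, 2]]

theorem stdBasis_eq_sum : ∀ l, stdBasis (ZMod 3) l =
    ∑ j : Fin 7, changeOfBasis l j.castSucc • sevenLinear^[j] imaginaryUnit +
      changeOfBasis l 7 • one (ZMod 3) := by
  decide +kernel

/-- `c` carries `imaginaryUnit` to a solution of the same equations, hence to a translate under
`seven`; the translates and the unit span the octonions. -/
theorem mem_zpowers_seven {c : G₂ (ZMod 3)} (hc : Commute c seven) :
    c ∈ Subgroup.zpowers seven := by
  have hcs : ∀ x, c • sevenLinear x = sevenLinear (c • x) := fun x =>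
    congrArg (· • x) hc.eq
  have hrel : imaginaryUnit ⋆ sevenLinear imaginaryUnit =
      sevenLinear (sevenLinear (sevenLinear imaginaryUnit)) := by decide +kernel
  have h := congrArg (c • ·) hrel
  simp only [smul_mul_eq, hcs] at h
  have hsq : imaginaryUnit ⋆ imaginaryUnit = -one (ZMod 3) := by decide +kernel
  have h' := congrArg (c • ·) hsq
  simp only [smul_mul_eq, smul_neg, smul_one_eq] at h'
  obtain ⟨i, hi⟩ := eq_iterate_sevenLinear h' h
  have hpow : ∀ (j : ℕ) x, seven ^ j • x = sevenLinear^[j] x := pow_smul_autOfPow _ _ _ _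
  refine mem_zpowers_of_commute hc (hi.trans (hpow i _).symm) fun f hf l => ?_
  rw [stdBasis_eq_sum]
  refine add_mem (sum_mem fun j _ => Submodule.smul_mem _ _ ?_)
    (Submodule.smul_mem _ _ (one_mem_fixedSubmodule f))
  rw [← hpow]
  exact hf j

/-- The cubic is the characteristic equation of the Singer cycle on the `v` part. It has no nonzero
solution in the `w` part or on the diagonal. -/
theorem eq_of_thirteenLinear_cubic {x : ZornMatrix (ZMod 3)}
    (h : thirteenLinear (thirteenLinear (thirteenLinear x)) =
      x - thirteenLinear (thirteenLinear x)) : x = (0, x.2.1, 0, 0) := by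
  have hw : ∀ w : Fin 3 → ZMod 3,
      (thirteenLinear (thirteenLinear (thirteenLinear (0, 0, w, 0)))).2.2.1 =
        w - (thirteenLinear (thirteenLinear (0, 0, w, 0))).2.2.1 → w = 0 := by decide +kernel
  have ha : ∀ a : ZMod 3, a = a - a → a = 0 := by decide
  exact Prod.ext (ha _ (congrArg (·.1) h)) (Prod.ext rfl (Prod.ext
    (hw _ (congrArg (·.2.2.1) h)) (ha _ (congrArg (·.2.2.2) h))))

/-- The `26` nonzero `v` vectors form two orbits, exchanged by `-1`. The relation has degree four on
the left and one on the right, so it excludes one of them. -/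
theorem eq_iterate_thirteenLinear_coords : ∀ v : Fin 3 → ZMod 3,
    let x : ZornMatrix (ZMod 3) := (0, v, 0, 0)
    x ⋆ thirteenLinear x ⋆ (thirteenLinear x ⋆ thirteenLinear (thirteenLinear x)) =
      thirteenLinear x → x ≠ 0 → ∃ i : Fin 13, x = thirteenLinear^[i] (stdBasis _ 1) := by
  decide +kernel

theorem eq_iterate_thirteenLinear {x : ZornMatrix (ZMod 3)}
    (h : thirteenLinear (thirteenLinear (thirteenLinear x)) = x - thirteenLinear (thirteenLinear x))
    (h' : x ⋆ thirteenLinear x ⋆ (thirteenLinear x ⋆ thirteenLinear (thirteenLinear x)) =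
      thirteenLinear x) (hne : x ≠ 0) : ∃ i : Fin 13, x = thirteenLinear^[i] (stdBasis _ 1) := by
  rw [eq_of_thirteenLinear_cubic h] at h' hne ⊢
  exact eq_iterate_thirteenLinear_coords x.2.1 h' hne

theorem mem_zpowers_thirteen {c : G₂ (ZMod 3)} (hc : Commute c thirteen) :
    c ∈ Subgroup.zpowers thirteen := by
  have hcs : ∀ x, c • thirteenLinear x = thirteenLinear (c • x) := fun x =>
    congrArg (· • x) hc.eq
  obtain ⟨v, hv⟩ : ∃ v, v = stdBasis (ZMod 3) 1 := ⟨_, rfl⟩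
  have hrel : thirteenLinear (thirteenLinear (thirteenLinear v)) =
      v - thirteenLinear (thirteenLinear v) := by rw [hv]; decide +kernel
  have hrel' : v ⋆ thirteenLinear v ⋆ (thirteenLinear v ⋆ thirteenLinear (thirteenLinear v)) =
      thirteenLinear v := by rw [hv]; decide +kernel
  have h := congrArg (c • ·) hrel
  have h' := congrArg (c • ·) hrel'
  simp only [smul_mul_eq, smul_sub, hcs] at h h'
  obtain ⟨i, hi⟩ := eq_iterate_thirteenLinear h h'
    (fun h0 => absurd (((smul_eq_zero_iff_eq c).1 h0).symm.trans hv) (by decide +kernel))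
  have hpow : ∀ (j : ℕ) x, thirteen ^ j • x = thirteenLinear^[j] x := pow_smul_autOfPow _ _ _ _
  rw [← hv] at hi
  refine mem_zpowers_of_commute hc (hi.trans (hpow i v).symm) fun f hf => ?_
  rw [hv] at hf
  have h1 : stdBasis _ 1 ∈ fixedSubmodule f := hf 0
  have h3 : stdBasis _ 3 ∈ fixedSubmodule f := by
    have e : stdBasis (ZMod 3) 3 = thirteenLinear^[1] (stdBasis _ 1) + stdBasis _ 1 := by
      decide +kernel
    rw [e, ← hpow]
    exact add_mem (hf 1) h1
  have h2 : stdBasis _ 2 ∈ fixedSubmodule f := by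
    have e : stdBasis (ZMod 3) 2 =
        thirteenLinear^[2] (stdBasis _ 1) - stdBasis _ 1 + stdBasis _ 3 := by
      decide +kernel
    rw [e, ← hpow]
    exact add_mem (sub_mem (hf 2) h1) h3
  -- The translates span the `v` part. Cross products give the `w` part, and a product of the two
  -- gives the diagonal idempotents.
  have h4 : stdBasis _ 4 ∈ fixedSubmodule f := by
    rw [show stdBasis (ZMod 3) 4 = stdBasis _ 2 ⋆ stdBasis _ 3 by decide +kernel]
    exact mul_mem_fixedSubmodule h2 h3
  have h5 : stdBasis _ 5 ∈ fixedSubmodule f := by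
    rw [show stdBasis (ZMod 3) 5 = stdBasis _ 3 ⋆ stdBasis _ 1 by decide +kernel]
    exact mul_mem_fixedSubmodule h3 h1
  have h6 : stdBasis _ 6 ∈ fixedSubmodule f := by
    rw [show stdBasis (ZMod 3) 6 = stdBasis _ 1 ⋆ stdBasis _ 2 by decide +kernel]
    exact mul_mem_fixedSubmodule h1 h2
  have h0 : stdBasis _ 0 ∈ fixedSubmodule f := by
    rw [show stdBasis (ZMod 3) 0 = stdBasis _ 1 ⋆ stdBasis _ 4 by decide +kernel]
    exact mul_mem_fixedSubmodule h1 h4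
  have h7 : stdBasis _ 7 ∈ fixedSubmodule f := by
    rw [show stdBasis (ZMod 3) 7 = one (ZMod 3) - stdBasis _ 0 by decide +kernel]
    exact sub_mem (one_mem_fixedSubmodule f) h0
  intro l
  fin_cases l <;> assumption

theorem hasEdgeTwoThree : HasEdgeTwoThree (G₂ (ZMod 3)) where
  exists_six := ⟨six, orderOf_six⟩
  exists_seven := ⟨seven, orderOf_seven⟩
  exists_thirteen := ⟨thirteen, orderOf_thirteen⟩
  prime_dvd g p hp hd := by
    rcases prime_dvd_card hp (hd.trans (orderOf_dvd_natCard g)) with h | h | rfl | rfl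
    · exact Or.inl h
    · exact Or.inr (Or.inl h)
    · exact Or.inr (Or.inr (Or.inl ⟨rfl, orderOf_eq_of_prime_dvd hp
        (not_sq_dvd_card hp (by norm_num)) orderOf_seven (fun _ => mem_zpowers_seven) g hd⟩))
    · exact Or.inr (Or.inr (Or.inr ⟨rfl, orderOf_eq_of_prime_dvd hp
        (not_sq_dvd_card hp (by norm_num)) orderOf_thirteen (fun _ => mem_zpowers_thirteen) g hd⟩))

end Zorn

/-! ### The main theorem -/

theorem mainTheorem6 {G : Type*} [Group G] (hG : Nonempty (G ≃* G₂ (ZMod 3))) :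
    IsUnrecognizable G ∧
    gruenbergKegelGraph G = gruenbergKegelGraph PSL(2, ZMod 13) ∧
    ∃ (K : Type) (_ : Field K) (_ : Finite K) (_ : CharP K 2)
      (V : Type) (_ : AddCommGroup V) (_ : Module K V)
      (ρ : Representation K PSL(2, ZMod 13) V),
      Module.finrank K V = 6 ∧
      ρ.IsIrreducible ∧
      (∀ g : PSL(2, ZMod 13), orderOf g = 7 ∨ orderOf g = 13 → ∀ v : V, ρ g v = v → v = 0) ∧
      gruenbergKegelGraph ρ.SemidirectGroup = gruenbergKegelGraph PSL(2, ZMod 13) ∧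
      gruenbergKegelGraph ρ.SemidirectGroup = gruenbergKegelGraph G := by
  obtain ⟨e⟩ := hG
  have hG := Zorn.hasEdgeTwoThree.of_mulEquiv e
  have hP := PSL2Thirteen.hasEdgeTwoThree
  have hfree := PSL2Thirteen.rep_sevenThirteenFree
  have hS := hfree.hasEdgeTwoThree hP
  exact ⟨isUnrecognizable_of_representation PSL2Thirteen.rep hfree hP hG,
    hG.gruenbergKegelGraph_eq hP, FieldFour, inferInstance, inferInstance, inferInstance,
    Fin 6 → FieldFour, inferInstance, inferInstance, PSL2Thirteen.rep, Module.finrank_fin_fun _,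
    PSL2Thirteen.rep_isIrreducible, hfree, hS.gruenbergKegelGraph_eq hP,
    hS.gruenbergKegelGraph_eq hG⟩
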